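/- **Setting.** Fix $a,q,\sigma_\pm,\beta\in(0,\infty)$ and $\mu_\pm>0$. Put $\theta^{\pm}_1=\frac{\sqrt{\mu_\pm^2+2q\sigma_\pm^2}+\mu_\pm}{\sigma_\pm^2}$, $\theta^{\pm}_2=\frac{\sqrt{\mu_\pm^2+2q\sigma_\pm^2}-\mu_\pm}{\sigma_\pm^2}$, $c_-=\frac{\theta_1^--\theta_1^+}{\theta_2^-+\theta_1^-}$, $c_+=\frac{\theta_2^+-\theta_2^-}{\theta_2^++\theta_1^+}$, $$g^-(x)=\begin{cases}e^{-\theta_1^+(x-a)},&x>a\\ c_-e^{\theta_2^-(x-a)}+(1-c_-)e^{-\theta_1^-(x-a)},&x\le a\end{cases}\qquad g^+(x)=\begin{cases}(1-c_+)e^{\theta_2^+(x-a)}+c_+e^{-\theta_1^+(x-a)},&x>a\\ e^{\theta_2^-(x-a)},&x\le a\end{cases}$$ and $g(x)=g^+(x)g^-(0)-g^-(x)g^+(0)$. Let $\mathcal D_\zeta=\{(x,y)\in[0,\infty)^2:x+\beta\le y\}$, $\zeta(z_1,z_2)=\frac{z_2-z_1-\beta}{g(z_2)-g(z_1)}$ on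 $\mathcal D_\zeta$, let $\mathcal M_\zeta$ be the set of global maximizers of $\zeta$ on $\mathcal D_\zeta$, and put $\psi(x,y)=\int_x^y\big(1-\frac{g'(s)}{g'(y)}\big)\,ds$. Put, whenever the logarithms are defined, $$x_0=\frac{\ln\frac{(g^+(0)-c_+g^-(0))(\theta_1^+)^2}{(1-c_+)g^-(0)(\theta_2^+)^2}}{\theta_2^++\theta_1^+}+a,\quad \Theta=c_+(\theta_1^+)^2+(1-c_+)(\theta_2^+)^2,\quad a_1=\frac{2\ln(\theta_1^- /\theta_2^-)}{\theta_2^-+\theta_1^-},$$ $$a_2=\frac{\ln\frac{\theta_2^++\theta_1^-}{\theta_2^+-\theta_2^-}}{\theta_1^-+\theta_2^-},\quad a_3=\frac{\ln\frac{(1-c_-c_+)(\theta_1^+)^2-(1-c_+)c_-(\theta_2^+)^2}{(1-c_-)\Theta}}{\theta_1^-+\theta_2^-}.$$ **Cases.** (i): $0<a_2\le a\le a_1$, $c_+>0$; or $0<a_3\le a\le a_1\wedge a_2$, $c_+>0$; or $0<a_3\le a\le a_1$, $c_+\le0$, $\Theta>0$. (ii): $a\le a_1\wedge a_2\wedge a_3$,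 $c_+>0$; or $a\le a_1$, $c_+\le0$, $\Theta\le0$; or $a\le a_1\wedge a_3$, $c_+\le0$, $\Theta>0$. (iii): $a_1\vee a_2\le a$, $c_+>0$; or $a_1\vee a_3\le a<a_2$, $c_+>0$; or $a_1\vee a_3\le a$, $c_+\le0$, $\Theta>0$. (iv): $a_1<a<a_2\wedge a_3$, $c_+>0$; or $a_1<a$, $c_+\le0$, $\Theta\le0$; or $a_1<a<a_3$, $c_+\le0$, $\Theta>0$. **Notation.** For $m>0$ let $\ell_m(y)=\inf\{z\in[0,m]:g'(z)\le y\}$ for $y\ge g'(m)$, and $\phi_m(x)=\psi(\ell_m(g'(x)),x)$ for $x\in[m,\infty)$; write $\phi=\phi_a$, $\bar\phi=\phi_{x_0}$, $\tilde\phi=\phi_{a_1}$. In Case (iv), let $(g')_1^{-1}=\ell_{a_1}$, let $(g')^{-1}_2,(g')^{-1}_3,(g')^{-1}_4$ be the inverses of $g'$ restricted to $[a_1,a]$, $[a,x_0]$, $[x_0,\infty)$, let $a_5=\inf\{x\ge x_0:g'(x)\ge g'(a_1)\}$, $a_6=(g')_4^{-1}(g'(a))$, and $$x_1=\inf\Big\{x\in[a_5,a_6]:\int_{(g')_1^{-1}(g'(x))}^{(g')_3^{-1}(g'(x))}\Big(1-\tfrac{g'(s)}{g'(x)}\Big)ds\ge0\Big\},\qquad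 x_2=\inf\big\{x\in[a_5,a_6]:\psi((g')_2^{-1}(g'(x)),x)\ge0\big\},$$ $\omega_1(x)=\psi((g')_1^{-1}(g'(x)),x)$ for $x\in[a_1,(g')_2^{-1}(g'(x_2))]\cup[x_2,\infty)$; $\omega_2(x)=\psi((g')_3^{-1}(g'(x)),x)$ for $x\in[x_0,x_1)$ and $\omega_2(x)=\psi((g')_1^{-1}(g'(x)),x)$ for $x\in[x_1,\infty)$. Let $\omega_i^{-1}(b)$ denote the preimage of $b$ in the domain of $\omega_i$, and $$\tilde Z=\{((g')_1^{-1}(g'(y)),y):y\in\omega_1^{-1}(\beta)\},\qquad \bar Z=\{((g')_3^{-1}(g'(y)),y):y\in\omega_2^{-1}(\beta)\}.$$ Let $A_1=\{b>0:g'(\omega_1^{-1}(b))<g'(\omega_2^{-1}(b))\}$, $A_2=\{b>0:g'(\omega_1^{-1}(b))>g'(\omega_2^{-1}(b))\}$, where $g'(\omega_i^{-1}(b))$ is the value of $g'$ at a point of $\omega_i^{-1}(b)$, read as $+\infty$ if $\omega_i^{-1}(b)=\emptyset$ (precisely: $b\in A_1$ iff some $y\in\omega_1^{-1}(b)$ satisfies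 $g'(y)<g'(w)$ for all $w\in\omega_2^{-1}(b)$, and symmetrically for $A_2$). Let $A_3=(\omega_2(x_1),\infty)$ and $\overline A=(0,\infty)\setminus A$. **Theorem.** Suppose $\mu_\pm>0$. * Under Case (i), $\phi:[a,\infty)\to[0,\infty)$ is a bijection and $\mathcal M_\zeta=\{(\ell_a(g'(\phi^{-1}(\beta))),\phi^{-1}(\beta))\}$. * Under Case (ii), $\bar\phi:[x_0,\infty)\to[0,\infty)$ is a bijection and $\mathcal M_\zeta=\{(\ell_{x_0}(g'(\bar\phi^{-1}(\beta))),\bar\phi^{-1}(\beta))\}$. * Under Case (iii), $\tilde\phi:[a_1,\infty)\to[0,\infty)$ is a bijection and $\mathcal M_\zeta=\{(\ell_{a_1}(g'(\tilde\phi^{-1}(\beta))),\tilde\phi^{-1}(\beta))\}$. * Under Case (iv), $a<x_0$, and $g'$ maps $[a_1,a]$, $[a,x_0]$, $[x_0,\infty)$ bijectively onto $[g'(a_1),g'(a)]$, $[g'(x_0),g'(a)]$, $[g'(x_0),\infty)$. The sets $\omega_1^{-1}(\beta)$, $\omega_2^{-1}(\beta)$ are not both empty; $\omega_2^{-1}(\beta)$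 has at most one element, and so has $\omega_1^{-1}(\beta)$ if $\beta\ne\omega_1(x_2)$. If $\beta=\omega_1(x_2)$, then $\omega_1^{-1}(\beta)=\{(g')_2^{-1}(g'(x_2)),x_2\}$ when $x_2>a_5$, and $\omega_1^{-1}(\beta)=\{x_2\}$ when $x_2=a_5$. Moreover $A_2\cap A_3=\emptyset$ and $$\mathcal M_\zeta=\begin{cases}\tilde Z,&\beta\in A_1\cup A_3,\\ \bar Z,&\beta\in A_2\cap\overline{A}_3,\\ \tilde Z\cup\bar Z,&\beta\in\overline{A_1\cup A_2\cup A_3},\end{cases}$$ where $\omega_1^{-1}(\beta)\neq\emptyset$ in the first case, $\omega_2^{-1}(\beta)\ne\emptyset$ in the second, and both are nonempty in the third. -/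

import Mathlib

open Set

noncomputable section

/-- Parameters of the refracted diffusion: threshold `a`, drifts `μp = μ₊`, `μm = μ₋`,
volatilities `σp = σ₊`, `σm = σ₋`, and discount rate `q`. -/
structure Model where
  a : ℝ
  μp : ℝ
  μm : ℝ
  σp : ℝ
  σm : ℝ
  q : ℝ
  a_pos : 0 < a
  σp_pos : 0 < σp
  σm_pos : 0 < σm
  q_pos : 0 < q

namespace Model

variable (P : Model)

/-- `θ₁⁺`. -/
def θ1p : ℝ := (Real.sqrt (P.μp ^ 2 + 2 * P.q * P.σp ^ 2) + P.μp) / P.σp ^ 2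
/-- `θ₂⁺`. -/
def θ2p : ℝ := (Real.sqrt (P.μp ^ 2 + 2 * P.q * P.σp ^ 2) - P.μp) / P.σp ^ 2
/-- `θ₁⁻`. -/
def θ1m : ℝ := (Real.sqrt (P.μm ^ 2 + 2 * P.q * P.σm ^ 2) + P.μm) / P.σm ^ 2
/-- `θ₂⁻`. -/
def θ2m : ℝ := (Real.sqrt (P.μm ^ 2 + 2 * P.q * P.σm ^ 2) - P.μm) / P.σm ^ 2

/-- `c₋`. -/
def cm : ℝ := (P.θ1m - P.θ1p) / (P.θ2m + P.θ1m)
/-- `c₊`. -/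
def cp : ℝ := (P.θ2p - P.θ2m) / (P.θ2p + P.θ1p)

/-- `g⁻`. -/
def gm (x : ℝ) : ℝ :=
  if P.a < x then Real.exp (-P.θ1p * (x - P.a))
  else P.cm * Real.exp (P.θ2m * (x - P.a)) + (1 - P.cm) * Real.exp (-P.θ1m * (x - P.a))

/-- `g⁺`. -/
def gp (x : ℝ) : ℝ :=
  if P.a < x then
    (1 - P.cp) * Real.exp (P.θ2p * (x - P.a)) + P.cp * Real.exp (-P.θ1p * (x - P.a))
  else Real.exp (P.θ2m * (x - P.a))

/-- `g(x) = g⁺(x) g⁻(0) - g⁻(x) g⁺(0)`. -/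
def g (x : ℝ) : ℝ := P.gp x * P.gm 0 - P.gm x * P.gp 0

/-- `g'`. -/
def g' (x : ℝ) : ℝ := deriv P.g x

/-- The domain `𝒟_ζ = {(x, y) ∈ [0,∞)² : x + β ≤ y}`. -/
def D (β : ℝ) : Set (ℝ × ℝ) := {z | 0 ≤ z.1 ∧ 0 ≤ z.2 ∧ z.1 + β ≤ z.2}

/-- `ζ(z₁, z₂) = (z₂ - z₁ - β) / (g(z₂) - g(z₁))`. -/
def ζ (β : ℝ) (z : ℝ × ℝ) : ℝ := (z.2 - z.1 - β) / (P.g z.2 - P.g z.1)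

/-- The set `ℳ_ζ` of global maximizers of `ζ` on `𝒟_ζ`. -/
def M (β : ℝ) : Set (ℝ × ℝ) := {z | z ∈ D β ∧ ∀ w ∈ D β, P.ζ β w ≤ P.ζ β z}

/-- `ψ(x, y) = ∫ₓ^y (1 - g'(s) / g'(y)) ds`. -/
def ψ (x y : ℝ) : ℝ := ∫ s in x..y, (1 - P.g' s / P.g' y)

/-! ### The constants `x₀, Θ, a₁, a₂, a₃` and the four cases -/

def x0 : ℝ :=
  Real.log (((P.gp 0 - P.cp * P.gm 0) * P.θ1p ^ 2) / ((1 - P.cp) * P.gm 0 * P.θ2p ^ 2))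
    / (P.θ2p + P.θ1p) + P.a

def Θ : ℝ := P.cp * P.θ1p ^ 2 + (1 - P.cp) * P.θ2p ^ 2

def a1 : ℝ := 2 * Real.log (P.θ1m / P.θ2m) / (P.θ2m + P.θ1m)

def a2 : ℝ := Real.log ((P.θ2p + P.θ1m) / (P.θ2p - P.θ2m)) / (P.θ1m + P.θ2m)

def a3 : ℝ :=
  Real.log (((1 - P.cm * P.cp) * P.θ1p ^ 2 - (1 - P.cp) * P.cm * P.θ2p ^ 2)
    / ((1 - P.cm) * P.Θ)) / (P.θ1m + P.θ2m)

def CaseI : Prop :=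
  (0 < P.a2 ∧ P.a2 ≤ P.a ∧ P.a ≤ P.a1 ∧ 0 < P.cp) ∨
  (0 < P.a3 ∧ P.a3 ≤ P.a ∧ P.a ≤ min P.a1 P.a2 ∧ 0 < P.cp) ∨
  (0 < P.a3 ∧ P.a3 ≤ P.a ∧ P.a ≤ P.a1 ∧ P.cp ≤ 0 ∧ 0 < P.Θ)

def CaseII : Prop :=
  (P.a ≤ min (min P.a1 P.a2) P.a3 ∧ 0 < P.cp) ∨
  (P.a ≤ P.a1 ∧ P.cp ≤ 0 ∧ P.Θ ≤ 0) ∨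
  (P.a ≤ min P.a1 P.a3 ∧ P.cp ≤ 0 ∧ 0 < P.Θ)

def CaseIII : Prop :=
  (max P.a1 P.a2 ≤ P.a ∧ 0 < P.cp) ∨
  (max P.a1 P.a3 ≤ P.a ∧ P.a < P.a2 ∧ 0 < P.cp) ∨
  (max P.a1 P.a3 ≤ P.a ∧ P.cp ≤ 0 ∧ 0 < P.Θ)

def CaseIV : Prop :=
  (P.a1 < P.a ∧ P.a < min P.a2 P.a3 ∧ 0 < P.cp) ∨
  (P.a1 < P.a ∧ P.cp ≤ 0 ∧ P.Θ ≤ 0) ∨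
  (P.a1 < P.a ∧ P.a < P.a3 ∧ P.cp ≤ 0 ∧ 0 < P.Θ)

/-! ### Inverse branches and the function `φ`, with turning point `m`
(`m = a`, `x₀`, `a₁` in the first three cases) -/

/-- The generalized inverse of `g'` on `[0, m]`: `y ↦ inf {z ∈ [0, m] : g'(z) ≤ y}`. -/
def invL (m y : ℝ) : ℝ := sInf {z | z ∈ Icc 0 m ∧ P.g' z ≤ y}

/-- `φ` with turning point `m`: `x ↦ ψ(invL m (g' x), x)`, for `x ∈ [m, ∞)`. -/
def φ (m x : ℝ) : ℝ := P.ψ (P.invL m (P.g' x)) x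

/-- The inverse of `φ m : [m, ∞) → [0, ∞)`. -/
def φinv (m b : ℝ) : ℝ := Function.invFunOn (P.φ m) (Ici m) b

/-! ### Objects of the fourth case -/

/-- `(g')₁⁻¹`. -/
def inv1 (y : ℝ) : ℝ := P.invL P.a1 y
/-- `(g')₂⁻¹`, the inverse of `g'` on `[a₁, a]`. -/
def inv2 (y : ℝ) : ℝ := Function.invFunOn P.g' (Icc P.a1 P.a) y
/-- `(g')₃⁻¹`, the inverse of `g'` on `[a, x₀]`. -/
def inv3 (y : ℝ) : ℝ := Function.invFunOn P.g' (Icc P.a P.x0) y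
/-- `(g')₄⁻¹`, the inverse of `g'` on `[x₀, ∞)`. -/
def inv4 (y : ℝ) : ℝ := Function.invFunOn P.g' (Ici P.x0) y

def a5 : ℝ := sInf {x | P.x0 ≤ x ∧ P.g' P.a1 ≤ P.g' x}

def a6 : ℝ := P.inv4 (P.g' P.a)

def x1 : ℝ :=
  sInf {x | x ∈ Icc P.a5 P.a6 ∧
    0 ≤ ∫ s in (P.inv1 (P.g' x))..(P.inv3 (P.g' x)), (1 - P.g' s / P.g' x)}

def x2 : ℝ :=
  sInf {x | x ∈ Icc P.a5 P.a6 ∧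
    0 ≤ ∫ s in (P.inv2 (P.g' x))..x, (1 - P.g' s / P.g' x)}

/-- The domain `[a₁, (g')₂⁻¹(g'(x₂))] ∪ [x₂, ∞)` of `ω₁`. -/
def domω1 : Set ℝ := Icc P.a1 (P.inv2 (P.g' P.x2)) ∪ Ici P.x2

def ω1 (x : ℝ) : ℝ := ∫ s in (P.inv1 (P.g' x))..x, (1 - P.g' s / P.g' x)

/-- `ω₂`, on the domain `[x₀, ∞)`. -/
def ω2 (x : ℝ) : ℝ :=
  if x < P.x1 then ∫ s in (P.inv3 (P.g' x))..x, (1 - P.g' s / P.g' x)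
  else ∫ s in (P.inv1 (P.g' x))..x, (1 - P.g' s / P.g' x)

/-- `ω₁⁻¹(b)` as a set: it has two elements at the exceptional value `b = ω₁(x₂)`. -/
def ω1inv (b : ℝ) : Set ℝ := {y | y ∈ P.domω1 ∧ P.ω1 y = b}

/-- `ω₂⁻¹(b)` as a set. -/
def ω2inv (b : ℝ) : Set ℝ := {y | P.x0 ≤ y ∧ P.ω2 y = b}

/-- The set `{(z̃₁, z̃₂)}`. -/
def zTilde (b : ℝ) : Set (ℝ × ℝ) := (fun y => (P.inv1 (P.g' y), y)) '' P.ω1inv b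

/-- The set `{(z̄₁, z̄₂)}`. -/
def zBar (b : ℝ) : Set (ℝ × ℝ) := (fun y => (P.inv3 (P.g' y), y)) '' P.ω2inv b

/-- `A₁ = {b > 0 : g'(ω₁⁻¹(b)) < g'(ω₂⁻¹(b))}`; a value `g'(ωᵢ⁻¹(b))` with `b` outside the range
of `ωᵢ` counts as `+∞`. -/
def A1 : Set ℝ := {b | 0 < b ∧ ∃ y ∈ P.ω1inv b, ∀ w ∈ P.ω2inv b, P.g' y < P.g' w}

/-- `A₂ = {b > 0 : g'(ω₁⁻¹(b)) > g'(ω₂⁻¹(b))}`, with the same convention. -/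
def A2 : Set ℝ := {b | 0 < b ∧ ∃ w ∈ P.ω2inv b, ∀ y ∈ P.ω1inv b, P.g' w < P.g' y}

/-- `A₃ = (ω₂(x₁), ∞)`. -/
def A3 : Set ℝ := Ioi (P.ω2 P.x1)

end Model

end

/-! ### Sums of two exponentials -/

/-! Let `c` be the reciprocal of the maximum of `ζ`; the maximum exists because `g'` tends to
infinity. Since `g` increases, `ζ ≤ 1/c` says that the net gain `(y - x) - (g y - g x) / c`, the
integral of `1 - g'/c`, is at most `β`, with equality exactly at the maximizers
(`exists_isOptimalLevel`). So the ratio problem asks which intervals have the largest net gain at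
level `c`. Varying one endpoint gives `g' y = c`, `g' x ≤ c`, and `g' x = c` if `x > 0`; lengthening
or shortening the interval puts `y` on an ascent of `g'` and `x` on a descent.

The parameters enter only through the shape of `g'`, a sum of two exponentials on each side of `a`.
The position of `a` relative to `a1` and the sign of `g''(a+)` decide between one valley, with
bottom `a`, `x0` or `a1`, and two valleys, with bottoms `a1` and `x0`.

One valley: the right end determines the interval, and its net gain `φ` increases strictly
(`φ_lt_φ`), so the maximizer is unique. Every `b > 0` is a value of `φ` because the problem with `b`
in place of `β` has a maximizer.

Two valleys: an optimal interval starts on the first descent, with right end in `ω1inv β`, or on the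
second, with right end in `ω2inv β` (`mem_M_cases`). Each point of either preimage gives an interval
of net gain `β` at its own level, which is impossible below `c`; hence `c` is the smaller of the two
levels, and `A1`, `A2` record which one that is. The points `x1` and `x2` discard intervals that
improve by prepending the first valley, or by adding or dropping the second. Past `x1`, `ω2` is
merely `ω1`, which explains `A3`. -/

theorem hasDerivAt_exp_pair (A B s t x : ℝ) :
    HasDerivAt (fun x => A * Real.exp (s * x) + B * Real.exp (-t * x))
      (A * s * Real.exp (s * x) - B * t * Real.exp (-t * x)) x := by
  have h1 : HasDerivAt (fun x => A * Real.exp (s * x)) (A * (Real.exp (s * x) * (s * 1))) x :=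
    (((hasDerivAt_id x).const_mul s).exp).const_mul A
  have h2 : HasDerivAt (fun x => B * Real.exp (-t * x)) (B * (Real.exp (-t * x) * (-t * 1))) x :=
    (((hasDerivAt_id x).const_mul (-t)).exp).const_mul B
  exact (h1.add h2).congr_deriv (by ring)

/-- The growing term of the derivative dominates at `x₀`, and its advantage only increases to the
right. `B` may have either sign, as `kB` does later. -/
theorem strictMonoOn_exp_pair {A B s t x₀ : ℝ} (hA : 0 < A) (hs : 0 < s) (ht : 0 < t)
    (h0 : B * t * Real.exp (-t * x₀) ≤ A * s * Real.exp (s * x₀)) :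
    StrictMonoOn (fun x => A * Real.exp (s * x) + B * Real.exp (-t * x)) (Ici x₀) := by
  apply strictMonoOn_of_deriv_pos (convex_Ici x₀) (by fun_prop)
  intro x hx
  rw [interior_Ici, mem_Ioi] at hx
  rw [(hasDerivAt_exp_pair A B s t x).deriv, sub_pos]
  have e1 : Real.exp (s * x₀) < Real.exp (s * x) := Real.exp_lt_exp.2 (by nlinarith)
  have e2 : Real.exp (-t * x) < Real.exp (-t * x₀) := Real.exp_lt_exp.2 (by nlinarith)
  have hAs : 0 < A * s := by positivity
  have e3 := mul_lt_mul_of_pos_left e1 hAs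
  rcases le_or_gt B 0 with hB | hB
  · have : B * t * Real.exp (-t * x) ≤ 0 :=
      mul_nonpos_of_nonpos_of_nonneg (mul_nonpos_of_nonpos_of_nonneg hB ht.le) (Real.exp_pos _).le
    have : 0 < A * s * Real.exp (s * x) := by positivity
    linarith
  · have e4 := mul_lt_mul_of_pos_left e2 (mul_pos hB ht)
    linarith

theorem strictAntiOn_exp_pair {A B s t x₀ : ℝ} (hA : 0 < A) (hB : 0 < B) (hs : 0 < s)
    (ht : 0 < t) (h0 : A * s * Real.exp (s * x₀) ≤ B * t * Real.exp (-t * x₀)) :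
    StrictAntiOn (fun x => A * Real.exp (s * x) + B * Real.exp (-t * x)) (Iic x₀) := by
  apply strictAntiOn_of_deriv_neg (convex_Iic x₀) (by fun_prop)
  intro x hx
  rw [interior_Iic, mem_Iio] at hx
  rw [(hasDerivAt_exp_pair A B s t x).deriv, sub_neg]
  have e1 : Real.exp (s * x) < Real.exp (s * x₀) := Real.exp_lt_exp.2 (by nlinarith)
  have e2 : Real.exp (-t * x₀) < Real.exp (-t * x) := Real.exp_lt_exp.2 (by nlinarith)
  have e3 := mul_lt_mul_of_pos_left e1 (mul_pos hA hs)
  have e4 := mul_lt_mul_of_pos_left e2 (mul_pos hB ht)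
  linarith

namespace Model

variable {P : Model}

/-! ### The exponents and the weights -/

theorem abs_drift_lt_sqrt {μ q σ : ℝ} (hq : 0 < q) (hσ : 0 < σ) :
    |μ| < Real.sqrt (μ ^ 2 + 2 * q * σ ^ 2) := by
  rw [← Real.sqrt_sq_eq_abs]
  exact Real.sqrt_lt_sqrt (sq_nonneg _) (by have : 0 < q * σ ^ 2 := by positivity
                                            linarith)

theorem θ1p_pos (P : Model) : 0 < P.θ1p :=
  div_pos (by have := neg_lt_of_abs_lt (abs_drift_lt_sqrt (μ := P.μp) P.q_pos P.σp_pos); linarith)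
    (pow_pos P.σp_pos 2)

theorem θ2p_pos (P : Model) : 0 < P.θ2p :=
  div_pos (by have := lt_of_abs_lt (abs_drift_lt_sqrt (μ := P.μp) P.q_pos P.σp_pos); linarith)
    (pow_pos P.σp_pos 2)

theorem θ1m_pos (P : Model) : 0 < P.θ1m :=
  div_pos (by have := neg_lt_of_abs_lt (abs_drift_lt_sqrt (μ := P.μm) P.q_pos P.σm_pos); linarith)
    (pow_pos P.σm_pos 2)

theorem θ2m_pos (P : Model) : 0 < P.θ2m :=
  div_pos (by have := lt_of_abs_lt (abs_drift_lt_sqrt (μ := P.μm) P.q_pos P.σm_pos); linarith)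
    (pow_pos P.σm_pos 2)

theorem θ2p_lt_θ1p (h : 0 < P.μp) : P.θ2p < P.θ1p :=
  div_lt_div_of_pos_right (by linarith) (pow_pos P.σp_pos 2)

theorem θ2m_lt_θ1m (h : 0 < P.μm) : P.θ2m < P.θ1m :=
  div_lt_div_of_pos_right (by linarith) (pow_pos P.σm_pos 2)

theorem cm_mul (P : Model) : P.cm * (P.θ2m + P.θ1m) = P.θ1m - P.θ1p :=
  div_mul_cancel₀ _ (add_pos P.θ2m_pos P.θ1m_pos).ne'

theorem cp_mul (P : Model) : P.cp * (P.θ2p + P.θ1p) = P.θ2p - P.θ2m :=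
  div_mul_cancel₀ _ (add_pos P.θ2p_pos P.θ1p_pos).ne'

theorem cm_lt_one (P : Model) : P.cm < 1 := by
  have := P.θ2m_pos; have := P.θ1p_pos
  exact (div_lt_one (add_pos P.θ2m_pos P.θ1m_pos)).2 (by linarith)

theorem cp_lt_one (P : Model) : P.cp < 1 := by
  have := P.θ2m_pos; have := P.θ1p_pos
  exact (div_lt_one (add_pos P.θ2p_pos P.θ1p_pos)).2 (by linarith)

/-! ### The two branches of `g` -/

theorem gp_of_le {x : ℝ} (hx : x ≤ P.a) : P.gp x = Real.exp (P.θ2m * (x - P.a)) :=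
  if_neg hx.not_gt

theorem gm_of_le {x : ℝ} (hx : x ≤ P.a) : P.gm x =
    P.cm * Real.exp (P.θ2m * (x - P.a)) + (1 - P.cm) * Real.exp (-P.θ1m * (x - P.a)) :=
  if_neg hx.not_gt

theorem gp_of_gt {x : ℝ} (hx : P.a < x) : P.gp x =
    (1 - P.cp) * Real.exp (P.θ2p * (x - P.a)) + P.cp * Real.exp (-P.θ1p * (x - P.a)) :=
  if_pos hx

theorem gm_of_gt {x : ℝ} (hx : P.a < x) : P.gm x = Real.exp (-P.θ1p * (x - P.a)) :=
  if_pos hx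

theorem gp_zero (P : Model) : P.gp 0 = Real.exp (-P.θ2m * P.a) := by
  rw [gp_of_le P.a_pos.le]; ring_nf

theorem gm_zero (P : Model) :
    P.gm 0 = P.cm * Real.exp (-P.θ2m * P.a) + (1 - P.cm) * Real.exp (P.θ1m * P.a) := by
  rw [gm_of_le P.a_pos.le]; ring_nf

theorem gp_zero_pos (P : Model) : 0 < P.gp 0 := P.gp_zero ▸ Real.exp_pos _

theorem gm_zero_pos (P : Model) : 0 < P.gm 0 := by
  have h := P.a_pos; have h1 := P.θ1m_pos; have h2 := P.θ2m_pos; have h3 := P.cm_lt_one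
  have : Real.exp (-P.θ2m * P.a) < Real.exp (P.θ1m * P.a) := Real.exp_lt_exp.2 (by nlinarith)
  have := Real.exp_pos (-P.θ2m * P.a)
  rw [gm_zero]; nlinarith

/-- The common coefficient of `g` on `(-∞, a]`. -/
noncomputable def kL (P : Model) : ℝ := (1 - P.cm) * Real.exp ((P.θ1m - P.θ2m) * P.a)

/-- The coefficient of the growing exponential of `g` on `[a, ∞)`. -/
noncomputable def kA (P : Model) : ℝ := (1 - P.cp) * P.gm 0

/-- Minus the coefficient of the decaying exponential of `g` on `[a, ∞)`. -/
noncomputable def kB (P : Model) : ℝ := P.gp 0 - P.cp * P.gm 0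

theorem kL_pos (P : Model) : 0 < P.kL :=
  mul_pos (sub_pos.2 P.cm_lt_one) (Real.exp_pos _)

theorem kA_pos (P : Model) : 0 < P.kA :=
  mul_pos (sub_pos.2 P.cp_lt_one) P.gm_zero_pos

/-- The `cm` terms of the two products cancel, leaving a multiple of a difference of exponentials
that vanishes at `0`. -/
theorem g_of_le {x : ℝ} (hx : x ≤ P.a) :
    P.g x = P.kL * Real.exp (P.θ2m * x) + (-P.kL) * Real.exp (-P.θ1m * x) := by
  rw [g, gp_of_le hx, gm_of_le hx, gm_zero, gp_zero, kL]
  have e1 : Real.exp (P.θ2m * (x - P.a)) =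
      Real.exp (P.θ2m * x) * Real.exp (-P.θ2m * P.a) := by rw [← Real.exp_add]; ring_nf
  have e2 : Real.exp (-P.θ1m * (x - P.a)) =
      Real.exp (-P.θ1m * x) * Real.exp (P.θ1m * P.a) := by rw [← Real.exp_add]; ring_nf
  have e3 : Real.exp ((P.θ1m - P.θ2m) * P.a) =
      Real.exp (P.θ1m * P.a) * Real.exp (-P.θ2m * P.a) := by rw [← Real.exp_add]; ring_nf
  rw [e1, e2, e3]; ring

theorem g_of_ge {x : ℝ} (hx : P.a ≤ x) :
    P.g x = P.kA * Real.exp (P.θ2p * (x - P.a)) + (-P.kB) * Real.exp (-P.θ1p * (x - P.a)) := by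
  rcases hx.eq_or_lt with rfl | hx
  · rw [g, gp_of_le le_rfl, gm_of_le le_rfl, kA, kB]
    simp only [sub_self, mul_zero, Real.exp_zero]; ring
  · rw [g, gp_of_gt hx, gm_of_gt hx, kA, kB]; ring

theorem hasDerivAt_left (P : Model) (x : ℝ) :
    HasDerivAt (fun x => P.kL * Real.exp (P.θ2m * x) + (-P.kL) * Real.exp (-P.θ1m * x))
      (P.kL * P.θ2m * Real.exp (P.θ2m * x) + P.kL * P.θ1m * Real.exp (-P.θ1m * x)) x :=
  (hasDerivAt_exp_pair _ _ _ _ x).congr_deriv (by ring)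

theorem hasDerivAt_right (P : Model) (x : ℝ) :
    HasDerivAt (fun x => P.kA * Real.exp (P.θ2p * (x - P.a)) +
        (-P.kB) * Real.exp (-P.θ1p * (x - P.a)))
      (P.kA * P.θ2p * Real.exp (P.θ2p * (x - P.a)) +
        P.kB * P.θ1p * Real.exp (-P.θ1p * (x - P.a))) x :=
  ((hasDerivAt_exp_pair P.kA (-P.kB) P.θ2p P.θ1p (x - P.a)).comp_sub_const x P.a).congr_deriv
    (by ring)

/-- Smooth fit at `a`: the equations defining `cm` and `cp` are the conditions for `g⁻` and `g⁺` to
be differentiable there. -/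
theorem slopes_match (P : Model) :
    P.kL * P.θ2m * Real.exp (P.θ2m * P.a) + P.kL * P.θ1m * Real.exp (-P.θ1m * P.a) =
      P.kA * P.θ2p + P.kB * P.θ1p := by
  have e1 : Real.exp ((P.θ1m - P.θ2m) * P.a) * Real.exp (P.θ2m * P.a) =
      Real.exp (P.θ1m * P.a) := by rw [← Real.exp_add]; ring_nf
  have e2 : Real.exp ((P.θ1m - P.θ2m) * P.a) * Real.exp (-P.θ1m * P.a) =
      Real.exp (-P.θ2m * P.a) := by rw [← Real.exp_add]; ring_nf
  have e3 := P.cm_mul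
  have e4 := P.cp_mul
  rw [kA, kB, kL, gm_zero, gp_zero]
  linear_combination (1 - P.cm) * P.θ2m * e1 + (1 - P.cm) * P.θ1m * e2 +
    (P.cm * Real.exp (-P.θ2m * P.a) + (1 - P.cm) * Real.exp (P.θ1m * P.a)) * e4 -
    Real.exp (-P.θ2m * P.a) * e3

theorem hasDerivAt_g_of_le {x : ℝ} (hx : x ≤ P.a) : HasDerivAt P.g
    (P.kL * P.θ2m * Real.exp (P.θ2m * x) + P.kL * P.θ1m * Real.exp (-P.θ1m * x)) x := by
  rcases hx.eq_or_lt with rfl | hx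
  · have hl : HasDerivWithinAt P.g _ (Iic P.a) P.a :=
      (P.hasDerivAt_left P.a).hasDerivWithinAt.congr (fun y hy => g_of_le hy) (g_of_le le_rfl)
    have hr : HasDerivWithinAt P.g _ (Ici P.a) P.a :=
      (P.hasDerivAt_right P.a).hasDerivWithinAt.congr (fun y hy => g_of_ge hy) (g_of_ge le_rfl)
    rw [sub_self, mul_zero, mul_zero, Real.exp_zero, mul_one, mul_one, ← slopes_match] at hr
    have := hl.union hr
    rwa [Iic_union_Ici, hasDerivWithinAt_univ] at this
  · refine (P.hasDerivAt_left x).congr_of_eventuallyEq ?_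
    filter_upwards [Iio_mem_nhds hx] with y hy using g_of_le (le_of_lt hy)

theorem hasDerivAt_g_of_ge {x : ℝ} (hx : P.a ≤ x) : HasDerivAt P.g
    (P.kA * P.θ2p * Real.exp (P.θ2p * (x - P.a)) +
      P.kB * P.θ1p * Real.exp (-P.θ1p * (x - P.a))) x := by
  rcases hx.eq_or_lt with rfl | hx
  · convert hasDerivAt_g_of_le le_rfl using 1
    rw [slopes_match]; simp
  · refine (P.hasDerivAt_right x).congr_of_eventuallyEq ?_
    filter_upwards [Ioi_mem_nhds hx] with y hy using g_of_ge (le_of_lt hy)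

theorem g'_of_le {x : ℝ} (hx : x ≤ P.a) :
    P.g' x = P.kL * P.θ2m * Real.exp (P.θ2m * x) + P.kL * P.θ1m * Real.exp (-P.θ1m * x) :=
  (hasDerivAt_g_of_le hx).deriv

theorem g'_of_ge {x : ℝ} (hx : P.a ≤ x) :
    P.g' x = P.kA * P.θ2p * Real.exp (P.θ2p * (x - P.a)) +
      P.kB * P.θ1p * Real.exp (-P.θ1p * (x - P.a)) :=
  (hasDerivAt_g_of_ge hx).deriv

theorem hasDerivAt_g (P : Model) (x : ℝ) : HasDerivAt P.g (P.g' x) x := by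
  rcases le_total x P.a with h | h
  · exact (hasDerivAt_g_of_le h).differentiableAt.hasDerivAt
  · exact (hasDerivAt_g_of_ge h).differentiableAt.hasDerivAt

theorem continuous_g (P : Model) : Continuous P.g :=
  continuous_iff_continuousAt.2 fun x => (P.hasDerivAt_g x).continuousAt

theorem continuous_g' (P : Model) : Continuous P.g' := by
  have hl : ContinuousOn P.g' (Iic P.a) :=
    ContinuousOn.congr (by fun_prop) fun x hx => g'_of_le hx
  have hr : ContinuousOn P.g' (Ici P.a) :=
    ContinuousOn.congr (by fun_prop) fun x hx => g'_of_ge hx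
  have := hl.union_of_isClosed hr isClosed_Iic isClosed_Ici
  rwa [Iic_union_Ici, continuousOn_univ] at this

/-- The delicate case is `kB < 0` to the right of `a`: there `g'` is at least its value at `a`,
which the left formula shows to be positive. -/
theorem g'_pos (P : Model) (x : ℝ) : 0 < P.g' x := by
  have := P.kL_pos; have := P.θ1m_pos; have := P.θ2m_pos
  have hA := P.kA_pos; have h1 := P.θ1p_pos; have h2 := P.θ2p_pos
  have hleft : ∀ x ≤ P.a, 0 < P.g' x := fun x hx => by rw [g'_of_le hx]; positivity
  rcases le_total x P.a with h | h
  · exact hleft x h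
  · rcases le_total 0 P.kB with hB | hB
    · rw [g'_of_ge h]; positivity
    · have ha := hleft P.a le_rfl
      rw [g'_of_ge le_rfl] at ha
      rw [g'_of_ge h]
      simp only [sub_self, mul_zero, Real.exp_zero, mul_one] at ha
      have e1 : 1 ≤ Real.exp (P.θ2p * (x - P.a)) :=
        Real.one_le_exp (mul_nonneg h2.le (sub_nonneg.2 h))
      have e2 : Real.exp (-P.θ1p * (x - P.a)) ≤ 1 :=
        Real.exp_le_one_iff.2 (by nlinarith)
      have e3 := mul_le_mul_of_nonneg_left e1 (mul_pos hA h2).le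
      have e4 := mul_le_mul_of_nonpos_left e2 (mul_nonpos_of_nonpos_of_nonneg hB h1.le)
      linarith

theorem tendsto_g'_atTop (P : Model) : Filter.Tendsto P.g' Filter.atTop Filter.atTop := by
  have hA := P.kA_pos; have h1 := P.θ1p_pos; have h2 := P.θ2p_pos
  have hx : Filter.Tendsto (fun x => P.θ2p * (x - P.a)) Filter.atTop Filter.atTop :=
    (Filter.tendsto_atTop_add_const_right _ (-P.a) Filter.tendsto_id).const_mul_atTop h2
  have ht := Filter.tendsto_atTop_add_const_right _ (-(|P.kB| * P.θ1p))
    ((Real.tendsto_exp_atTop.comp hx).const_mul_atTop (mul_pos hA h2))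
  refine Filter.tendsto_atTop_mono' _ ?_ ht
  filter_upwards [Filter.eventually_ge_atTop P.a] with x hx
  rw [g'_of_ge hx]
  have e2 : Real.exp (-P.θ1p * (x - P.a)) ≤ 1 := Real.exp_le_one_iff.2 (by nlinarith)
  have e3 := Real.exp_pos (-P.θ1p * (x - P.a))
  have e5 : |P.kB * P.θ1p * Real.exp (-P.θ1p * (x - P.a))| ≤ |P.kB| * P.θ1p := by
    rw [abs_mul, abs_mul, abs_of_pos h1, abs_of_pos e3]
    exact mul_le_of_le_one_right (by positivity) e2
  have := neg_le_of_abs_le e5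
  simp only [Function.comp]
  linarith

/-! ### Monotonicity of `g'` -/

theorem exp_a1 (P : Model) : Real.exp ((P.θ2m + P.θ1m) * P.a1) = (P.θ1m / P.θ2m) ^ 2 := by
  have h1 := P.θ1m_pos; have h2 := P.θ2m_pos
  rw [a1, mul_div_cancel₀ _ (add_pos h2 h1).ne', two_mul, Real.exp_add,
    Real.exp_log (div_pos h1 h2), sq]

theorem a1_pos (h : 0 < P.μm) : 0 < P.a1 := by
  have h1 := P.θ1m_pos; have h2 := P.θ2m_pos
  exact div_pos (mul_pos two_pos (Real.log_pos ((one_lt_div h2).2 (θ2m_lt_θ1m h))))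
    (add_pos h2 h1)

/-- `a1` is the zero of the second derivative of the left expression for `g`. -/
theorem left_balance_a1 (P : Model) :
    P.kL * P.θ1m * P.θ1m * Real.exp (-P.θ1m * P.a1) =
      P.kL * P.θ2m * P.θ2m * Real.exp (P.θ2m * P.a1) := by
  have h2 := P.θ2m_pos
  have e : Real.exp (P.θ2m * P.a1) =
      Real.exp ((P.θ2m + P.θ1m) * P.a1) * Real.exp (-P.θ1m * P.a1) := by
    rw [← Real.exp_add]; ring_nf
  rw [e, exp_a1]; field_simp

theorem strictAntiOn_g'_left {m : ℝ} (h1 : m ≤ P.a1) (h2 : m ≤ P.a) :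
    StrictAntiOn P.g' (Iic m) := by
  refine ((strictAntiOn_exp_pair (mul_pos P.kL_pos P.θ2m_pos) (mul_pos P.kL_pos P.θ1m_pos)
    P.θ2m_pos P.θ1m_pos P.left_balance_a1.ge).mono (Iic_subset_Iic.2 h1)).congr ?_
  exact fun x hx => (g'_of_le (le_trans hx h2)).symm

theorem strictMonoOn_g'_left (P : Model) : StrictMonoOn P.g' (Icc P.a1 P.a) := by
  refine ((strictMonoOn_exp_pair (mul_pos P.kL_pos P.θ2m_pos)
    P.θ2m_pos P.θ1m_pos P.left_balance_a1.le).mono Icc_subset_Ici_self).congr ?_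
  exact fun x hx => (g'_of_le hx.2).symm

theorem strictMonoOn_g'_right {x₀ : ℝ} (h0 : P.a ≤ x₀)
    (h : P.kB * P.θ1p * P.θ1p * Real.exp (-P.θ1p * (x₀ - P.a)) ≤
      P.kA * P.θ2p * P.θ2p * Real.exp (P.θ2p * (x₀ - P.a))) :
    StrictMonoOn P.g' (Ici x₀) := by
  intro x hx y hy hxy
  rw [g'_of_ge (h0.trans hx), g'_of_ge (h0.trans hy)]
  exact strictMonoOn_exp_pair (mul_pos P.kA_pos P.θ2p_pos) P.θ2p_pos P.θ1p_pos h
    (a := x - P.a) (b := y - P.a) (sub_le_sub_right (mem_Ici.1 hx) _)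
    (sub_le_sub_right (mem_Ici.1 hy) _) (sub_lt_sub_right hxy _)

theorem strictAntiOn_g'_right {x₀ : ℝ} (hB : 0 < P.kB)
    (h : P.kA * P.θ2p * P.θ2p * Real.exp (P.θ2p * (x₀ - P.a)) ≤
      P.kB * P.θ1p * P.θ1p * Real.exp (-P.θ1p * (x₀ - P.a))) :
    StrictAntiOn P.g' (Icc P.a x₀) := by
  intro x hx y hy hxy
  rw [g'_of_ge hx.1, g'_of_ge hy.1]
  exact strictAntiOn_exp_pair (mul_pos P.kA_pos P.θ2p_pos) (mul_pos hB P.θ1p_pos) P.θ2p_pos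
    P.θ1p_pos h (a := x - P.a) (b := y - P.a) (sub_le_sub_right hx.2 _) (sub_le_sub_right hy.2 _)
    (sub_lt_sub_right hxy _)

theorem x0_ratio_pos (hB : 0 < P.kB) : 0 < P.kB * P.θ1p ^ 2 / (P.kA * P.θ2p ^ 2) := by
  have := P.kA_pos; have := P.θ1p_pos; have := P.θ2p_pos
  positivity

theorem x0_sub_a (P : Model) : (P.θ2p + P.θ1p) * (P.x0 - P.a) =
    Real.log (P.kB * P.θ1p ^ 2 / (P.kA * P.θ2p ^ 2)) := by
  rw [x0, add_sub_cancel_right, mul_div_cancel₀ _ (add_pos P.θ2p_pos P.θ1p_pos).ne']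
  rfl

/-- `x0` is the zero of the second derivative of the right expression for `g`; it exists only for
`kB > 0`. -/
theorem right_balance_x0 (hB : 0 < P.kB) :
    P.kB * P.θ1p * P.θ1p * Real.exp (-P.θ1p * (P.x0 - P.a)) =
      P.kA * P.θ2p * P.θ2p * Real.exp (P.θ2p * (P.x0 - P.a)) := by
  have := P.kA_pos; have := P.θ1p_pos; have := P.θ2p_pos
  have e : Real.exp (P.θ2p * (P.x0 - P.a)) =
      Real.exp ((P.θ2p + P.θ1p) * (P.x0 - P.a)) * Real.exp (-P.θ1p * (P.x0 - P.a)) := by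
    rw [← Real.exp_add]; ring_nf
  rw [e, x0_sub_a, Real.exp_log (x0_ratio_pos hB)]; field_simp

theorem kB_pos_of_le (h : P.kA * P.θ2p ^ 2 ≤ P.kB * P.θ1p ^ 2) : 0 < P.kB := by
  have := P.kA_pos; have := P.θ1p_pos; have := P.θ2p_pos
  have : 0 < P.kB * P.θ1p ^ 2 := lt_of_lt_of_le (by positivity) h
  exact pos_of_mul_pos_left this (by positivity)

theorem a_le_x0 (h : P.kA * P.θ2p ^ 2 ≤ P.kB * P.θ1p ^ 2) : P.a ≤ P.x0 := by
  have := P.kA_pos; have h1 := P.θ1p_pos; have h2 := P.θ2p_pos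
  have : 0 ≤ (P.θ2p + P.θ1p) * (P.x0 - P.a) := by
    rw [x0_sub_a]
    exact Real.log_nonneg ((one_le_div (by positivity)).2 h)
  exact sub_nonneg.1 (nonneg_of_mul_nonneg_right this (add_pos h2 h1))

theorem a_lt_x0 (h : P.kA * P.θ2p ^ 2 < P.kB * P.θ1p ^ 2) : P.a < P.x0 := by
  have := P.kA_pos; have h1 := P.θ1p_pos; have h2 := P.θ2p_pos
  have : 0 < (P.θ2p + P.θ1p) * (P.x0 - P.a) := by
    rw [x0_sub_a]
    exact Real.log_pos ((one_lt_div (by positivity)).2 h)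
  exact sub_pos.1 (pos_of_mul_pos_right this (add_pos h2 h1).le)

theorem strictMonoOn_g'_Ici_a (h : P.kB * P.θ1p ^ 2 ≤ P.kA * P.θ2p ^ 2) :
    StrictMonoOn P.g' (Ici P.a) :=
  strictMonoOn_g'_right le_rfl (by simpa [sq, mul_assoc] using h)

theorem strictMonoOn_g'_Ici_x0 (h : P.kA * P.θ2p ^ 2 ≤ P.kB * P.θ1p ^ 2) :
    StrictMonoOn P.g' (Ici P.x0) :=
  strictMonoOn_g'_right (a_le_x0 h) (right_balance_x0 (kB_pos_of_le h)).le

theorem strictAntiOn_g'_Icc_a_x0 (h : P.kA * P.θ2p ^ 2 ≤ P.kB * P.θ1p ^ 2) :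
    StrictAntiOn P.g' (Icc P.a P.x0) :=
  strictAntiOn_g'_right (kB_pos_of_le h) (right_balance_x0 (kB_pos_of_le h)).ge

/-! ### The thresholds `a₂` and `a₃` -/

/-- The left side is `-g''(a+)`. The bracket is affine in `exp ((θ1m + θ2m) * a)`, and for `Θ > 0`
it vanishes exactly when `a = a3`. -/
theorem curvature_diff (P : Model) : P.kB * P.θ1p ^ 2 - P.kA * P.θ2p ^ 2 =
    Real.exp (-P.θ2m * P.a) * (P.θ1p ^ 2 - P.cm * P.Θ -
      (1 - P.cm) * P.Θ * Real.exp ((P.θ1m + P.θ2m) * P.a)) := by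
  have e : Real.exp (P.θ1m * P.a) =
      Real.exp ((P.θ1m + P.θ2m) * P.a) * Real.exp (-P.θ2m * P.a) := by
    rw [← Real.exp_add]; ring_nf
  rw [kA, kB, Θ, gm_zero, gp_zero, e]; ring

/-- The gap is `(1 - cp) * (θ1p ^ 2 - θ2p ^ 2)`, positive because a positive drift makes `θ1p` the
larger exponent. -/
theorem Θ_lt (h : 0 < P.μp) : P.Θ < P.θ1p ^ 2 := by
  have h1 := P.θ2p_pos; have h2 := θ2p_lt_θ1p h; have h3 := P.cp_lt_one
  rw [Θ]
  nlinarith [mul_pos (sub_pos.2 h3) (mul_pos (sub_pos.2 h2) (add_pos h1 P.θ1p_pos))]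

theorem a3_numerator_pos (h : 0 < P.μp) (hΘ : 0 < P.Θ) : 0 < P.θ1p ^ 2 - P.cm * P.Θ := by
  nlinarith [Θ_lt h, P.cm_lt_one]

theorem exp_a3 (h : 0 < P.μp) (hΘ : 0 < P.Θ) :
    (1 - P.cm) * P.Θ * Real.exp ((P.θ1m + P.θ2m) * P.a3) = P.θ1p ^ 2 - P.cm * P.Θ := by
  have hm := sub_pos.2 P.cm_lt_one
  have hn := a3_numerator_pos h hΘ
  have e : (1 - P.cm * P.cp) * P.θ1p ^ 2 - (1 - P.cp) * P.cm * P.θ2p ^ 2 =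
      P.θ1p ^ 2 - P.cm * P.Θ := by rw [Θ]; ring
  rw [a3, mul_div_cancel₀ _ (add_pos P.θ1m_pos P.θ2m_pos).ne', e,
    Real.exp_log (div_pos hn (mul_pos hm hΘ)), mul_div_cancel₀ _ (mul_pos hm hΘ).ne']

theorem curvature_diff_of_Θ_pos (h : 0 < P.μp) (hΘ : 0 < P.Θ) :
    P.kB * P.θ1p ^ 2 - P.kA * P.θ2p ^ 2 = Real.exp (-P.θ2m * P.a) * ((1 - P.cm) * P.Θ) *
      (Real.exp ((P.θ1m + P.θ2m) * P.a3) - Real.exp ((P.θ1m + P.θ2m) * P.a)) := by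
  rw [curvature_diff, ← exp_a3 h hΘ]; ring

theorem curvature_coeff_pos (hΘ : 0 < P.Θ) :
    0 < Real.exp (-P.θ2m * P.a) * ((1 - P.cm) * P.Θ) :=
  mul_pos (Real.exp_pos _) (mul_pos (sub_pos.2 P.cm_lt_one) hΘ)

theorem curvature_le_iff (h : 0 < P.μp) (hΘ : 0 < P.Θ) :
    P.kA * P.θ2p ^ 2 ≤ P.kB * P.θ1p ^ 2 ↔ P.a ≤ P.a3 := by
  rw [← sub_nonneg, curvature_diff_of_Θ_pos h hΘ,
    mul_nonneg_iff_of_pos_left (curvature_coeff_pos hΘ), sub_nonneg, Real.exp_le_exp,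
    mul_le_mul_iff_right₀ (add_pos P.θ1m_pos P.θ2m_pos)]

theorem curvature_lt_iff (h : 0 < P.μp) (hΘ : 0 < P.Θ) :
    P.kA * P.θ2p ^ 2 < P.kB * P.θ1p ^ 2 ↔ P.a < P.a3 := by
  rw [← sub_pos, curvature_diff_of_Θ_pos h hΘ,
    mul_pos_iff_of_pos_left (curvature_coeff_pos hΘ), sub_pos, Real.exp_lt_exp,
    mul_lt_mul_iff_right₀ (add_pos P.θ1m_pos P.θ2m_pos)]

theorem curvature_ge_of_a3_le (h : 0 < P.μp) (hΘ : 0 < P.Θ) (ha : P.a3 ≤ P.a) :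
    P.kB * P.θ1p ^ 2 ≤ P.kA * P.θ2p ^ 2 :=
  not_lt.1 fun hc => absurd ((curvature_lt_iff h hΘ).1 hc) ha.not_gt

theorem curvature_lt_of_Θ_nonpos (hΘ : P.Θ ≤ 0) : P.kA * P.θ2p ^ 2 < P.kB * P.θ1p ^ 2 := by
  have e : P.kB * P.θ1p ^ 2 - P.kA * P.θ2p ^ 2 = P.gp 0 * P.θ1p ^ 2 - P.gm 0 * P.Θ := by
    rw [kA, kB, Θ]; ring
  have h1 := mul_pos P.gp_zero_pos (pow_pos P.θ1p_pos 2)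
  have h2 := mul_nonpos_of_nonneg_of_nonpos P.gm_zero_pos.le hΘ
  linarith

theorem Θ_pos_of_cp_pos (h : 0 < P.cp) : 0 < P.Θ :=
  add_pos (mul_pos h (pow_pos P.θ1p_pos 2))
    (mul_pos (sub_pos.2 P.cp_lt_one) (pow_pos P.θ2p_pos 2))

/-- For `cp > 0`, `a2` is the value of `a` at which `kB` changes sign. Once `kB ≤ 0`, the right
expression for `g'` is increasing. -/
theorem kB_nonpos_of_a2_le (h : 0 < P.cp) (ha : P.a2 ≤ P.a) : P.kB ≤ 0 := by
  have hs := add_pos P.θ1m_pos P.θ2m_pos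
  have hp := add_pos P.θ2p_pos P.θ1p_pos
  have hd : 0 < P.θ2p - P.θ2m := P.cp_mul ▸ mul_pos h hp
  have h1 := P.θ2p_pos; have h2 := P.θ1m_pos
  have hr : 0 < (P.θ2p + P.θ1m) / (P.θ2p - P.θ2m) := by positivity
  have e1 : (P.θ2p + P.θ1m) / (P.θ2p - P.θ2m) ≤ Real.exp ((P.θ1m + P.θ2m) * P.a) := by
    rw [← Real.log_le_iff_le_exp hr]
    rw [a2, div_le_iff₀ hs] at ha
    linarith
  rw [div_le_iff₀ hd] at e1
  have e2 : Real.exp (P.θ1m * P.a) =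
      Real.exp ((P.θ1m + P.θ2m) * P.a) * Real.exp (-P.θ2m * P.a) := by
    rw [← Real.exp_add]; ring_nf
  -- Clearing the denominators of `cp` and `cm` factors `kB`; the last factor is the one that
  -- vanishes at `a = a2`.
  have e3 : P.kB * ((P.θ2p + P.θ1p) * (P.θ2m + P.θ1m)) =
      Real.exp (-P.θ2m * P.a) * (P.θ2m + P.θ1p) * ((P.θ2p + P.θ1m) -
        Real.exp ((P.θ1m + P.θ2m) * P.a) * (P.θ2p - P.θ2m)) := by
    have e4 := P.cm_mul
    have e5 := P.cp_mul
    rw [kB, gm_zero, gp_zero, e2]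
    generalize Real.exp ((P.θ1m + P.θ2m) * P.a) = E
    generalize Real.exp (-P.θ2m * P.a) = H
    linear_combination (-(H * P.cm + (1 - P.cm) * E * H) * (P.θ2m + P.θ1m)) * e5 -
      (H - E * H) * (P.θ2p - P.θ2m) * e4
  have h3 := P.θ2m_pos; have h4 := P.θ1p_pos
  have : P.kB * ((P.θ2p + P.θ1p) * (P.θ2m + P.θ1m)) ≤ 0 := by
    rw [e3]
    exact mul_nonpos_of_nonneg_of_nonpos (by positivity) (by linarith)
  exact nonpos_of_mul_nonpos_left this (by positivity)

theorem curvature_ge_of_a2_le (h : 0 < P.cp) (ha : P.a2 ≤ P.a) :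
    P.kB * P.θ1p ^ 2 ≤ P.kA * P.θ2p ^ 2 :=
  (mul_nonpos_of_nonpos_of_nonneg (kB_nonpos_of_a2_le h ha) (sq_nonneg _)).trans
    (mul_pos P.kA_pos (pow_pos P.θ2p_pos 2)).le

/-! ### The shape of `g'` in the four cases -/

/-- Only two comparisons matter: `a` with `a1`, and `kB * θ1p ^ 2` with `kA * θ2p ^ 2`. The
conditions on `a2`, `a3` and `Θ` serve to settle the second; the same holds in the other cases. -/
theorem CaseI.shape (hμp : 0 < P.μp) (h : P.CaseI) :
    StrictAntiOn P.g' (Icc 0 P.a) ∧ StrictMonoOn P.g' (Ici P.a) := by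
  have key : P.a ≤ P.a1 ∧ P.kB * P.θ1p ^ 2 ≤ P.kA * P.θ2p ^ 2 := by
    rcases h with ⟨-, h2, h1, hc⟩ | ⟨-, h3, h1, hc⟩ | ⟨-, h3, h1, -, hΘ⟩
    · exact ⟨h1, curvature_ge_of_a2_le hc h2⟩
    · exact ⟨(le_min_iff.1 h1).1, curvature_ge_of_a3_le hμp (Θ_pos_of_cp_pos hc) h3⟩
    · exact ⟨h1, curvature_ge_of_a3_le hμp hΘ h3⟩
  exact ⟨(strictAntiOn_g'_left key.1 le_rfl).mono Icc_subset_Iic_self,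
    strictMonoOn_g'_Ici_a key.2⟩

theorem CaseII.shape (hμp : 0 < P.μp) (h : P.CaseII) :
    P.a ≤ P.x0 ∧ StrictAntiOn P.g' (Icc 0 P.x0) ∧ StrictMonoOn P.g' (Ici P.x0) := by
  have key : P.a ≤ P.a1 ∧ P.kA * P.θ2p ^ 2 ≤ P.kB * P.θ1p ^ 2 := by
    rcases h with ⟨h1, hc⟩ | ⟨h1, -, hΘ⟩ | ⟨h1, -, hΘ⟩
    · exact ⟨(le_min_iff.1 (le_min_iff.1 h1).1).1,
        (curvature_le_iff hμp (Θ_pos_of_cp_pos hc)).2 (le_min_iff.1 h1).2⟩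
    · exact ⟨h1, (curvature_lt_of_Θ_nonpos hΘ).le⟩
    · exact ⟨(le_min_iff.1 h1).1, (curvature_le_iff hμp hΘ).2 (le_min_iff.1 h1).2⟩
  have hax := a_le_x0 key.2
  refine ⟨hax, ?_, strictMonoOn_g'_Ici_x0 key.2⟩
  rw [← Icc_union_Icc_eq_Icc P.a_pos.le hax]
  exact ((strictAntiOn_g'_left key.1 le_rfl).mono Icc_subset_Iic_self).union
    (strictAntiOn_g'_Icc_a_x0 key.2) (isGreatest_Icc P.a_pos.le) (isLeast_Icc hax)

theorem CaseIII.shape (hμp : 0 < P.μp) (h : P.CaseIII) :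
    StrictAntiOn P.g' (Icc 0 P.a1) ∧ StrictMonoOn P.g' (Ici P.a1) := by
  have key : P.a1 ≤ P.a ∧ P.kB * P.θ1p ^ 2 ≤ P.kA * P.θ2p ^ 2 := by
    rcases h with ⟨h1, hc⟩ | ⟨h1, -, hc⟩ | ⟨h1, -, hΘ⟩
    · exact ⟨(max_le_iff.1 h1).1, curvature_ge_of_a2_le hc (max_le_iff.1 h1).2⟩
    · exact ⟨(max_le_iff.1 h1).1,
        curvature_ge_of_a3_le hμp (Θ_pos_of_cp_pos hc) (max_le_iff.1 h1).2⟩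
    · exact ⟨(max_le_iff.1 h1).1, curvature_ge_of_a3_le hμp hΘ (max_le_iff.1 h1).2⟩
  refine ⟨(strictAntiOn_g'_left le_rfl key.1).mono Icc_subset_Iic_self, ?_⟩
  rw [← Icc_union_Ici_eq_Ici key.1]
  exact P.strictMonoOn_g'_left.union (strictMonoOn_g'_Ici_a key.2) (isGreatest_Icc key.1)
    isLeast_Ici

theorem CaseIV.shape (hμp : 0 < P.μp) (h : P.CaseIV) :
    P.a1 < P.a ∧ P.a < P.x0 ∧ StrictAntiOn P.g' (Icc 0 P.a1) ∧
      StrictMonoOn P.g' (Icc P.a1 P.a) ∧ StrictAntiOn P.g' (Icc P.a P.x0) ∧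
      StrictMonoOn P.g' (Ici P.x0) := by
  have key : P.a1 < P.a ∧ P.kA * P.θ2p ^ 2 < P.kB * P.θ1p ^ 2 := by
    rcases h with ⟨h1, h2, hc⟩ | ⟨h1, -, hΘ⟩ | ⟨h1, h2, -, hΘ⟩
    · exact ⟨h1, (curvature_lt_iff hμp (Θ_pos_of_cp_pos hc)).2 (lt_min_iff.1 h2).2⟩
    · exact ⟨h1, curvature_lt_of_Θ_nonpos hΘ⟩
    · exact ⟨h1, (curvature_lt_iff hμp hΘ).2 h2⟩
  exact ⟨key.1, a_lt_x0 key.2,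
    (strictAntiOn_g'_left le_rfl key.1.le).mono Icc_subset_Iic_self, P.strictMonoOn_g'_left,
    strictAntiOn_g'_Icc_a_x0 key.2.le, strictMonoOn_g'_Ici_x0 key.2.le⟩

end Model

namespace Model

variable {P : Model}

/-! ### Net gain of an interval at a level -/

/-- The integral of `1 - g' / c` over `[x, y]`. -/
noncomputable def net (P : Model) (c x y : ℝ) : ℝ := (y - x) - (P.g y - P.g x) / c

theorem net_add (P : Model) (c x y z : ℝ) : P.net c x y + P.net c y z = P.net c x z := by
  rw [net, net, net]; ring

theorem net_self (P : Model) (c x : ℝ) : P.net c x x = 0 := by simp [net]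

theorem integral_eq_net (P : Model) (c x y : ℝ) :
    ∫ s in x..y, (1 - P.g' s / c) = P.net c x y := by
  have hd : ∀ s ∈ uIcc x y, HasDerivAt (fun s => s - P.g s / c) (1 - P.g' s / c) s :=
    fun s _ => (hasDerivAt_id s).sub ((P.hasDerivAt_g s).div_const c)
  have hc : Continuous fun s => 1 - P.g' s / c := by
    have := P.continuous_g'
    fun_prop
  rw [intervalIntegral.integral_eq_sub_of_hasDerivAt hd (hc.intervalIntegrable _ _), net]
  ring

theorem ψ_eq_net (P : Model) (x y : ℝ) : P.ψ x y = P.net (P.g' y) x y :=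
  P.integral_eq_net _ _ _

theorem φ_eq_net (P : Model) (m x : ℝ) :
    P.φ m x = P.net (P.g' x) (P.invL m (P.g' x)) x := P.ψ_eq_net _ _

theorem exists_g_sub (P : Model) {x y : ℝ} (h : x < y) :
    ∃ s ∈ Ioo x y, P.g y - P.g x = P.g' s * (y - x) := by
  obtain ⟨s, hs, e⟩ := exists_hasDerivAt_eq_slope P.g P.g' h P.continuous_g.continuousOn
    fun s _ => P.hasDerivAt_g s
  exact ⟨s, hs, by rw [e, div_mul_cancel₀ _ (sub_pos.2 h).ne']⟩

theorem strictMono_g (P : Model) : StrictMono P.g := by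
  intro x y h
  obtain ⟨s, -, e⟩ := P.exists_g_sub h
  exact sub_pos.1 (e ▸ mul_pos (P.g'_pos s) (sub_pos.2 h))

/-- The mean value theorem turns pointwise comparisons of `g'` with `c` into signs of net gains. -/
theorem exists_net_eq (P : Model) (c : ℝ) {x y : ℝ} (h : x < y) :
    ∃ s ∈ Ioo x y, P.net c x y = (y - x) * (1 - P.g' s / c) := by
  obtain ⟨s, hs, e⟩ := P.exists_g_sub h
  exact ⟨s, hs, by rw [net, e]; ring⟩

theorem net_pos {c x y : ℝ} (hc : 0 < c) (h : x < y) (hs : ∀ s ∈ Ioo x y, P.g' s < c) :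
    0 < P.net c x y := by
  obtain ⟨s, hs', e⟩ := P.exists_net_eq c h
  rw [e]
  exact mul_pos (sub_pos.2 h) (sub_pos.2 ((div_lt_one hc).2 (hs s hs')))

theorem net_neg {c x y : ℝ} (hc : 0 < c) (h : x < y) (hs : ∀ s ∈ Ioo x y, c < P.g' s) :
    P.net c x y < 0 := by
  obtain ⟨s, hs', e⟩ := P.exists_net_eq c h
  rw [e]
  exact mul_neg_of_pos_of_neg (sub_pos.2 h) (sub_neg.2 ((one_lt_div hc).2 (hs s hs')))

theorem net_nonneg {c x y : ℝ} (hc : 0 < c) (h : x ≤ y) (hs : ∀ s ∈ Ioo x y, P.g' s ≤ c) :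
    0 ≤ P.net c x y := by
  rcases h.eq_or_lt with rfl | h
  · rw [net_self]
  obtain ⟨s, hs', e⟩ := P.exists_net_eq c h
  rw [e]
  exact mul_nonneg (sub_nonneg.2 h.le) (sub_nonneg.2 ((div_le_one hc).2 (hs s hs')))

theorem net_nonpos {c x y : ℝ} (hc : 0 < c) (h : x ≤ y) (hs : ∀ s ∈ Ioo x y, c ≤ P.g' s) :
    P.net c x y ≤ 0 := by
  rcases h.eq_or_lt with rfl | h
  · rw [net_self]
  obtain ⟨s, hs', e⟩ := P.exists_net_eq c h
  rw [e]
  exact mul_nonpos_of_nonneg_of_nonpos (sub_nonneg.2 h.le)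
    (sub_nonpos.2 ((one_le_div hc).2 (hs s hs')))

theorem net_lt_net {c d x y : ℝ} (hc : 0 < c) (hcd : c < d) (h : x < y) :
    P.net c x y < P.net d x y :=
  sub_lt_sub_left (div_lt_div_of_pos_left (sub_pos.2 (P.strictMono_g h)) hc hcd) _

theorem net_le_net {c d x y : ℝ} (hc : 0 < c) (hcd : c ≤ d) (h : x ≤ y) :
    P.net c x y ≤ P.net d x y :=
  sub_le_sub_left (div_le_div_of_nonneg_left (sub_nonneg.2 (P.strictMono_g.monotone h)) hc hcd) _

/-! ### Existence of maximizers and the optimal level -/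

theorem g_sub_pos_of_mem_D {β : ℝ} (hβ : 0 < β) {z : ℝ × ℝ} (hz : z ∈ D β) :
    0 < P.g z.2 - P.g z.1 :=
  sub_pos.2 (P.strictMono_g (by have := hz.2.2; linarith))

theorem isClosed_D (β : ℝ) : IsClosed (D β) :=
  (isClosed_le continuous_const continuous_fst).inter
    ((isClosed_le continuous_const continuous_snd).inter
      (isClosed_le (continuous_fst.add continuous_const) continuous_snd))

theorem continuousOn_ζ {β : ℝ} (hβ : 0 < β) : ContinuousOn (P.ζ β) (D β) := by
  have := P.continuous_g
  exact ContinuousOn.div (by fun_prop) (by fun_prop) fun z hz => (g_sub_pos_of_mem_D hβ hz).ne'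

/-- If `g' ≥ k` from `z₂ / 2` on, then `g` gains at least `k / 2` per unit length on `[z₁, z₂]`. -/
theorem half_mul_le_g_sub {k x y : ℝ} (hx : 0 ≤ x) (hxy : x ≤ y)
    (hk0 : 0 ≤ k) (hk : ∀ s, y / 2 ≤ s → k ≤ P.g' s) : k * (y - x) / 2 ≤ P.g y - P.g x := by
  rcases hxy.eq_or_lt with rfl | hxy
  · simp
  have hw : max x (y / 2) < y := max_lt hxy (by linarith)
  obtain ⟨s, hs, e⟩ := P.exists_g_sub hw
  have h1 := hk s ((le_max_right _ _).trans hs.1.le)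
  have h2 : P.g x ≤ P.g (max x (y / 2)) := P.strictMono_g.monotone (le_max_left _ _)
  have h3 : (y - x) / 2 ≤ y - max x (y / 2) := by
    rcases max_cases x (y / 2) with ⟨h, -⟩ | ⟨h, -⟩ <;> rw [h] <;> linarith
  have h4 : k * ((y - x) / 2) ≤ P.g' s * (y - max x (y / 2)) :=
    mul_le_mul h1 h3 (by linarith) (hk0.trans h1)
  linarith

/-- `g` eventually grows so steeply that points with large second coordinate cannot beat `(0, 2 *
β)`; a compact set remains. -/
theorem M_nonempty {β : ℝ} (hβ : 0 < β) : (P.M β).Nonempty := by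
  have hw : ((0 : ℝ), 2 * β) ∈ D β := ⟨le_rfl, by positivity, by simp; linarith⟩
  have hζ : 0 < P.ζ β (0, 2 * β) :=
    div_pos (by simp; linarith) (g_sub_pos_of_mem_D hβ hw)
  -- With slope at least `2 / ζ(0, 2β)` beyond `R`, and half the interval beyond `R`, the increment
  -- of `g` is at least `(y - x) / ζ(0, 2β)`.
  obtain ⟨R, hR⟩ := Filter.eventually_atTop.1
    (P.tendsto_g'_atTop.eventually_ge_atTop (2 / P.ζ β (0, 2 * β)))
  have hcomp : IsCompact (D β ∩ Icc 0 (max (2 * R) (2 * β)) ×ˢ Icc 0 (max (2 * R) (2 * β))) :=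
    (isCompact_Icc.prod isCompact_Icc).inter_left (isClosed_D β)
  have hwmem : ((0 : ℝ), 2 * β) ∈
      D β ∩ Icc 0 (max (2 * R) (2 * β)) ×ˢ Icc 0 (max (2 * R) (2 * β)) :=
    ⟨hw, ⟨le_rfl, le_max_of_le_right (by positivity)⟩, ⟨by positivity, le_max_right _ _⟩⟩
  obtain ⟨z, hz, hmax⟩ := hcomp.exists_isMaxOn ⟨_, hwmem⟩
    ((continuousOn_ζ hβ).mono inter_subset_left)
  refine ⟨z, hz.1, fun w hw' => ?_⟩
  by_cases hwR : w.2 ≤ max (2 * R) (2 * β)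
  · have h1 : w.1 ≤ w.2 := by have := hw'.2.2; linarith
    exact hmax ⟨hw', ⟨hw'.1, h1.trans hwR⟩, ⟨hw'.2.1, hwR⟩⟩
  · refine le_trans ?_ (hmax hwmem)
    have h1 : w.1 < w.2 := by have := hw'.2.2; linarith
    have h2 : 2 * R < w.2 := (le_max_left _ _).trans_lt (not_le.1 hwR)
    have h3 := half_mul_le_g_sub (P := P) hw'.1 h1.le (div_pos two_pos hζ).le
      fun s hs => hR s (by linarith)
    change (w.2 - w.1 - β) / (P.g w.2 - P.g w.1) ≤ _
    rw [div_le_iff₀ (g_sub_pos_of_mem_D hβ hw')]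
    have h4 := mul_le_mul_of_nonneg_left h3 hζ.le
    have h5 : P.ζ β (0, 2 * β) * (2 / P.ζ β (0, 2 * β) * (w.2 - w.1) / 2) = w.2 - w.1 := by
      field_simp
    linarith

/-- `c` is the reciprocal of the maximum of `ζ`: net gains at level `c` are at most `β`, and the
maximizers of `ζ` are the intervals whose net gain is `β`. -/
structure IsOptimalLevel (P : Model) (β c : ℝ) : Prop where
  pos : 0 < c
  net_le : ∀ x y, 0 ≤ x → x ≤ y → P.net c x y ≤ β
  mem_M : ∀ x y, (x, y) ∈ P.M β ↔ 0 ≤ x ∧ x ≤ y ∧ P.net c x y = β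

/-- Multiplying `ζ ≤ max ζ` by the positive increment of `g` makes it linear: `y - x - max ζ * (g y
- g x) ≤ β`. -/
theorem exists_isOptimalLevel {β : ℝ} (hβ : 0 < β) : ∃ c, P.IsOptimalLevel β c := by
  obtain ⟨z, hz⟩ := P.M_nonempty hβ
  have hw : ((0 : ℝ), 2 * β) ∈ D β := ⟨le_rfl, by positivity, by simp; linarith⟩
  have hζ : 0 < P.ζ β z :=
    (div_pos (by simp; linarith) (g_sub_pos_of_mem_D hβ hw)).trans_le (hz.2 _ hw)
  have hnet : ∀ x y, P.net (1 / P.ζ β z) x y = (y - x) - P.ζ β z * (P.g y - P.g x) := by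
    intro x y; rw [net]; field_simp
  refine ⟨1 / P.ζ β z, one_div_pos.2 hζ, ?_, ?_⟩
  · intro x y hx hxy
    rw [hnet]
    by_cases hD : x + β ≤ y
    · have hmem : (x, y) ∈ D β := ⟨hx, hx.trans hxy, hD⟩
      have := hz.2 _ hmem
      rw [ζ, div_le_iff₀ (g_sub_pos_of_mem_D hβ hmem)] at this
      simp only at this
      linarith
    -- Outside the domain `y - x < β`, and the increment of `g` only lowers the net gain.
    · have := mul_nonneg hζ.le (sub_nonneg.2 (P.strictMono_g.monotone hxy))
      linarith
  · intro x y
    rw [hnet]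
    constructor
    · intro h
      have e : P.ζ β (x, y) = P.ζ β z := le_antisymm (hz.2 _ h.1) (h.2 _ hz.1)
      have hle : x ≤ y := by have := h.1.2.2; simp only at this; linarith
      refine ⟨h.1.1, hle, ?_⟩
      rw [← e, ζ, div_mul_cancel₀ _ (g_sub_pos_of_mem_D hβ h.1).ne']
      ring
    · rintro ⟨hx, hxy, h⟩
      have h0 := mul_nonneg hζ.le (sub_nonneg.2 (P.strictMono_g.monotone hxy))
      have hmem : (x, y) ∈ D β := ⟨hx, hx.trans hxy, by simp only; linarith⟩
      have e : P.ζ β (x, y) = P.ζ β z := by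
        rw [ζ.eq_1 P β (x, y), div_eq_iff (g_sub_pos_of_mem_D hβ hmem).ne']
        simp only
        linarith
      exact ⟨hmem, fun w hw => e ▸ hz.2 w hw⟩

/-- Net gain increases strictly with the level, so a gain of `β` below `c` would exceed `β` at `c`.
-/
theorem IsOptimalLevel.le_of_net_eq {β c d x y : ℝ} (h : P.IsOptimalLevel β c) (hβ : 0 < β)
    (hd : 0 < d) (hx : 0 ≤ x) (hxy : x ≤ y) (e : P.net d x y = β) : c ≤ d := by
  by_contra! hlt
  have hne : x < y := hxy.lt_of_ne (by rintro rfl; rw [net_self] at e; exact hβ.ne e)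
  have := net_lt_net (P := P) hd hlt hne
  linarith [h.net_le x y hx hxy]

/-! ### Conditions at the ends of an optimal interval -/

section Optimal

variable {β c x y : ℝ}

theorem IsOptimalLevel.lt (h : P.IsOptimalLevel β c) (hβ : 0 < β) (hz : (x, y) ∈ P.M β) :
    x < y := by
  obtain ⟨-, h2, e⟩ := (h.mem_M x y).1 hz
  exact h2.lt_of_ne (by rintro rfl; rw [net_self] at e; exact hβ.ne e)

theorem IsOptimalLevel.net_right_nonpos (h : P.IsOptimalLevel β c) (hz : (x, y) ∈ P.M β) {w : ℝ}
    (hw : y ≤ w) : P.net c y w ≤ 0 := by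
  obtain ⟨h1, h2, e⟩ := (h.mem_M x y).1 hz
  linarith [h.net_le x w h1 (h2.trans hw), P.net_add c x y w]

theorem IsOptimalLevel.net_suffix_nonneg (h : P.IsOptimalLevel β c) (hz : (x, y) ∈ P.M β) {w : ℝ}
    (hw : x ≤ w) : 0 ≤ P.net c w y := by
  obtain ⟨h1, h2, e⟩ := (h.mem_M x y).1 hz
  linarith [h.net_le x w h1 hw, P.net_add c x w y]

theorem IsOptimalLevel.net_left_nonpos (h : P.IsOptimalLevel β c) (hz : (x, y) ∈ P.M β) {w : ℝ}
    (hw0 : 0 ≤ w) (hw : w ≤ x) : P.net c w x ≤ 0 := by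
  obtain ⟨h1, h2, e⟩ := (h.mem_M x y).1 hz
  linarith [h.net_le w y hw0 (hw.trans h2), P.net_add c w x y]

theorem IsOptimalLevel.net_prefix_nonneg (h : P.IsOptimalLevel β c) (hz : (x, y) ∈ P.M β) {w : ℝ}
    (hw0 : 0 ≤ w) (hw : w ≤ y) : 0 ≤ P.net c x w := by
  obtain ⟨h1, h2, e⟩ := (h.mem_M x y).1 hz
  linarith [h.net_le w y hw0 hw, P.net_add c x w y]

theorem hasDerivAt_net_right (P : Model) (c x y : ℝ) :
    HasDerivAt (fun w => P.net c x w) (1 - P.g' y / c) y :=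
  ((hasDerivAt_id y).sub_const x).sub (((P.hasDerivAt_g y).sub_const (P.g x)).div_const c)

theorem hasDerivAt_net_left (P : Model) (c x y : ℝ) :
    HasDerivAt (fun w => P.net c w y) (-1 - -P.g' x / c) x :=
  ((hasDerivAt_id x).const_sub y).sub (((P.hasDerivAt_g x).const_sub (P.g y)).div_const c)

/-- First-order condition: `y` is an interior maximum of the net gain with `x` fixed. -/
theorem IsOptimalLevel.g'_right (h : P.IsOptimalLevel β c) (hβ : 0 < β) (hz : (x, y) ∈ P.M β) :
    P.g' y = c := by
  have hlt := h.lt hβ hz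
  obtain ⟨h1, h2, e⟩ := (h.mem_M x y).1 hz
  have hmax : IsLocalMax (fun w => P.net c x w) y := by
    filter_upwards [Ioi_mem_nhds hlt] with w hw
    exact e ▸ h.net_le x w h1 (le_of_lt hw)
  have := hmax.hasDerivAt_eq_zero (P.hasDerivAt_net_right c x y)
  exact ((div_eq_one_iff_eq h.pos.ne').1 (sub_eq_zero.1 this).symm)

/-- Were `g' x > c`, cutting off a short piece at the left end would raise the net gain. This also
covers `x = 0`, where only rightward variation is allowed. -/
theorem IsOptimalLevel.g'_left_le (h : P.IsOptimalLevel β c) (hβ : 0 < β)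
    (hz : (x, y) ∈ P.M β) : P.g' x ≤ c := by
  by_contra! hc
  have hlt := h.lt hβ hz
  obtain ⟨ε, hε, hball⟩ := Metric.eventually_nhds_iff.1
    (P.continuous_g'.continuousAt.eventually (lt_mem_nhds hc))
  have hw : x < min (x + ε) y := lt_min (by linarith) hlt
  refine absurd (h.net_prefix_nonneg hz (((h.mem_M x y).1 hz).1.trans hw.le)
    (min_le_right (x + ε) y)) (not_le.2 (net_neg h.pos hw fun s hs => hball ?_))
  rw [Real.dist_eq, abs_of_pos (sub_pos.2 hs.1)]
  linarith [hs.2.trans_le (min_le_left (x + ε) y)]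

theorem IsOptimalLevel.g'_left (h : P.IsOptimalLevel β c) (hβ : 0 < β) (hz : (x, y) ∈ P.M β)
    (hx : 0 < x) : P.g' x = c := by
  have hlt := h.lt hβ hz
  obtain ⟨-, -, e⟩ := (h.mem_M x y).1 hz
  have hmax : IsLocalMax (fun w => P.net c w y) x := by
    filter_upwards [Ioo_mem_nhds hx hlt] with w hw
    exact e ▸ h.net_le w y hw.1.le hw.2.le
  have h3 := hmax.hasDerivAt_eq_zero (P.hasDerivAt_net_left c x y)
  have h4 : P.g' x / c = 1 := by rw [neg_div] at h3; linarith
  exact (div_eq_one_iff_eq h.pos.ne').1 h4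

/-- If `g'` fell after `y`, it would drop below `c` and extending the interval would gain. -/
theorem IsOptimalLevel.not_strictAntiOn_right (h : P.IsOptimalLevel β c) (hβ : 0 < β)
    (hz : (x, y) ∈ P.M β) {w : ℝ} (hw : y < w) : ¬ StrictAntiOn P.g' (Icc y w) := fun ha =>
  absurd (h.net_right_nonpos hz hw.le) (not_le.2 (net_pos h.pos hw fun _ hs =>
    h.g'_right hβ hz ▸ ha (left_mem_Icc.2 hw.le) (Ioo_subset_Icc_self hs) hs.1))

theorem IsOptimalLevel.not_strictAntiOn_left (h : P.IsOptimalLevel β c) (hβ : 0 < β)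
    (hz : (x, y) ∈ P.M β) {w : ℝ} (hw : w < y) : ¬ StrictAntiOn P.g' (Icc w y) := fun ha =>
  absurd (h.net_suffix_nonneg hz (le_max_right w x)) (not_le.2 (net_neg h.pos
    (max_lt hw (h.lt hβ hz)) fun _ hs => h.g'_right hβ hz ▸
      ha ⟨(le_max_left w x).trans hs.1.le, hs.2.le⟩ (right_mem_Icc.2 hw.le) hs.2))

theorem IsOptimalLevel.not_strictMonoOn_left (h : P.IsOptimalLevel β c) (hβ : 0 < β)
    (hz : (x, y) ∈ P.M β) {w : ℝ} (hw0 : 0 ≤ w) (hw : w < x) :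
    ¬ StrictMonoOn P.g' (Icc w x) := fun ha =>
  absurd (h.net_left_nonpos hz hw0 hw.le) (not_le.2 (net_pos h.pos hw fun _ hs =>
    (ha (Ioo_subset_Icc_self hs) (right_mem_Icc.2 hw.le) hs.2).trans_le (h.g'_left_le hβ hz)))

end Optimal

/-! ### The generalized inverse on the first decreasing branch -/

section InvL

variable {m c d : ℝ}

/-- The minimum covers levels above `g' 0`, where the generalized inverse is `0`. -/
theorem invL_eq_of_g'_eq (ha : StrictAntiOn P.g' (Icc 0 m)) {z : ℝ} (hz : z ∈ Icc 0 m)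
    (e : P.g' z = min c (P.g' 0)) : P.invL m c = z := by
  refine IsLeast.csInf_eq ⟨⟨hz, e.trans_le (min_le_left _ _)⟩, fun w hw => ?_⟩
  rw [← ha.le_iff_ge hw.1 hz, e]
  exact le_min hw.2 (ha.antitoneOn (left_mem_Icc.2 (hw.1.1.trans hw.1.2)) hw.1 hw.1.1)

theorem invL_spec (ha : StrictAntiOn P.g' (Icc 0 m)) (hm : 0 ≤ m) (hc : P.g' m ≤ c) :
    P.invL m c ∈ Icc 0 m ∧ P.g' (P.invL m c) = min c (P.g' 0) := by
  have h0 : P.g' m ≤ P.g' 0 := ha.antitoneOn (left_mem_Icc.2 hm) (right_mem_Icc.2 hm) hm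
  obtain ⟨z, hz, e⟩ := intermediate_value_Icc' hm P.continuous_g'.continuousOn
    (show min c (P.g' 0) ∈ Icc (P.g' m) (P.g' 0) from ⟨le_min hc h0, min_le_right _ _⟩)
  rw [invL_eq_of_g'_eq ha hz e]
  exact ⟨hz, e⟩

theorem invL_anti (ha : StrictAntiOn P.g' (Icc 0 m)) (hm : 0 ≤ m) (hc : P.g' m ≤ c)
    (hcd : c ≤ d) : P.invL m d ≤ P.invL m c := by
  obtain ⟨h1, e1⟩ := invL_spec ha hm hc
  obtain ⟨h2, e2⟩ := invL_spec ha hm (hc.trans hcd)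
  rw [← ha.le_iff_ge h1 h2, e1, e2]
  exact min_le_min_right _ hcd

theorem g'_le_of_invL_le (ha : StrictAntiOn P.g' (Icc 0 m)) (hm : 0 ≤ m) (hc : P.g' m ≤ c)
    {s : ℝ} (h1 : P.invL m c ≤ s) (h2 : s ≤ m) : P.g' s ≤ c := by
  obtain ⟨h3, e⟩ := invL_spec ha hm hc
  exact (ha.antitoneOn h3 ⟨h3.1.trans h1, h2⟩ h1).trans (e.trans_le (min_le_left _ _))

theorem net_invL_nonneg (ha : StrictAntiOn P.g' (Icc 0 m)) (hm : 0 ≤ m) (hc : P.g' m ≤ c)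
    (hcd : c ≤ d) : 0 ≤ P.net d (P.invL m d) (P.invL m c) :=
  net_nonneg ((P.g'_pos m).trans_le (hc.trans hcd)) (invL_anti ha hm hc hcd) fun _ hs =>
    g'_le_of_invL_le ha hm (hc.trans hcd) hs.1.le (hs.2.le.trans (invL_spec ha hm hc).1.2)

/-- The interval for `y` consists of the one for `x` and a piece on either side. At the higher level
the common part gains no less, the left piece is nonnegative and the right piece is positive.
Monotonicity of `g'` on `[m, ∞)` is not needed, so the lemma serves both ascents of the two-valley
case. -/
theorem φ_lt_φ (ha : StrictAntiOn P.g' (Icc 0 m)) (hm : 0 ≤ m) {x y : ℝ} (hmx : m ≤ x)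
    (hc : P.g' m ≤ P.g' x) (hxy : x < y) (hg : ∀ s ∈ Ico x y, P.g' s < P.g' y) :
    P.φ m x < P.φ m y := by
  have hg' := (hg x (left_mem_Ico.2 hxy)).le
  rw [φ_eq_net, φ_eq_net, ← P.net_add _ _ (P.invL m (P.g' x)) y, ← P.net_add _ _ x y]
  have h1 := net_invL_nonneg ha hm hc hg'
  have h2 := net_le_net (P := P) (P.g'_pos x) hg' ((invL_spec ha hm hc).1.2.trans hmx)
  have h3 := net_pos (P.g'_pos y) hxy fun s hs => hg s (Ioo_subset_Ico_self hs)
  linarith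

theorem φ_self (ha : StrictAntiOn P.g' (Icc 0 m)) (hm : 0 ≤ m) : P.φ m m = 0 := by
  have h0 : P.g' m ≤ P.g' 0 := ha.antitoneOn (left_mem_Icc.2 hm) (right_mem_Icc.2 hm) hm
  rw [φ_eq_net, invL_eq_of_g'_eq ha (right_mem_Icc.2 hm) (min_eq_left h0).symm, net_self]

theorem IsOptimalLevel.left_eq_invL {β x y : ℝ} (h : P.IsOptimalLevel β c) (hβ : 0 < β)
    (hz : (x, y) ∈ P.M β) (ha : StrictAntiOn P.g' (Icc 0 m)) (hx : x ≤ m) :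
    P.invL m c = x := by
  have hx0 := ((h.mem_M x y).1 hz).1
  refine invL_eq_of_g'_eq ha ⟨hx0, hx⟩ ?_
  rcases hx0.eq_or_lt with rfl | hx1
  · exact (min_eq_right (h.g'_left_le hβ hz)).symm
  · have e := h.g'_left hβ hz hx1
    rw [e, min_eq_left]
    exact e ▸ ha.antitoneOn (left_mem_Icc.2 (hx0.trans hx)) ⟨hx0, hx⟩ hx0

end InvL

/-! ### A single valley -/

section Valley

variable {m : ℝ}

theorem strictMonoOn_φ (ha : StrictAntiOn P.g' (Icc 0 m)) (hb : StrictMonoOn P.g' (Ici m))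
    (hm : 0 ≤ m) : StrictMonoOn (P.φ m) (Ici m) := fun _ hx _ hy hxy =>
  φ_lt_φ ha hm hx (hb.monotoneOn self_mem_Ici hx hx) hxy fun _ hs =>
    hb (mem_Ici.2 (le_trans hx hs.1)) hy hs.2

/-- An optimal interval cannot end on the descent nor start on the ascent, since extending it would
gain. -/
theorem eq_of_mem_M_of_valley (ha : StrictAntiOn P.g' (Icc 0 m))
    (hb : StrictMonoOn P.g' (Ici m)) (hm : 0 ≤ m) {β x y : ℝ} (hβ : 0 < β)
    (hz : (x, y) ∈ P.M β) : m ≤ y ∧ x = P.invL m (P.g' y) ∧ P.φ m y = β := by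
  obtain ⟨c, h⟩ := P.exists_isOptimalLevel hβ
  obtain ⟨hx0, hxy, e⟩ := (h.mem_M x y).1 hz
  have hy : m ≤ y := by
    by_contra! hlt
    exact h.not_strictAntiOn_right hβ hz hlt (ha.mono (Icc_subset_Icc_left (hx0.trans hxy)))
  have hx : x ≤ m := by
    by_contra! hlt
    exact h.not_strictMonoOn_left hβ hz hm hlt (hb.mono Icc_subset_Ici_self)
  have hl := h.left_eq_invL hβ hz ha hx
  refine ⟨hy, ?_, ?_⟩
  · rw [h.g'_right hβ hz, hl]
  · rw [φ_eq_net, h.g'_right hβ hz, hl, e]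

/-- Surjectivity comes from existence of maximizers: one for the parameter `b` exhibits `b` as a
value of `φ`. -/
theorem bijOn_φ_of_valley (ha : StrictAntiOn P.g' (Icc 0 m)) (hb : StrictMonoOn P.g' (Ici m))
    (hm : 0 ≤ m) : BijOn (P.φ m) (Ici m) (Ici 0) := by
  have hmono := strictMonoOn_φ ha hb hm
  refine ⟨fun x hx => ?_, hmono.injOn, fun b hb0 => ?_⟩
  · have := hmono.monotoneOn self_mem_Ici hx hx
    rwa [φ_self ha hm] at this
  · rcases (mem_Ici.1 hb0).eq_or_lt with rfl | hb0
    · exact ⟨m, self_mem_Ici, φ_self ha hm⟩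
    · obtain ⟨⟨x, y⟩, hz⟩ := P.M_nonempty hb0
      obtain ⟨h1, -, h2⟩ := eq_of_mem_M_of_valley ha hb hm hb0 hz
      exact ⟨y, h1, h2⟩

theorem M_eq_of_valley (ha : StrictAntiOn P.g' (Icc 0 m)) (hb : StrictMonoOn P.g' (Ici m))
    (hm : 0 ≤ m) {β : ℝ} (hβ : 0 < β) :
    P.M β = {(P.invL m (P.g' (P.φinv m β)), P.φinv m β)} := by
  have hbij := bijOn_φ_of_valley ha hb hm
  refine (P.M_nonempty hβ).subset_singleton_iff.1 ?_
  rintro ⟨x, y⟩ hz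
  obtain ⟨h1, h2, h3⟩ := eq_of_mem_M_of_valley ha hb hm hβ hz
  have : P.φinv m β = y := by
    rw [← h3]
    exact hbij.injOn.leftInvOn_invFunOn h1
  rw [mem_singleton_iff, this, ← h2]

end Valley

end Model

/-! ### First sign changes and continuity of inverse branches -/

/-- The set is closed, so its infimum is attained. If that is not `u`, then `f u < 0`, and the
intermediate value theorem gives a zero, which cannot precede the infimum. -/
theorem sInf_nonneg_spec {f : ℝ → ℝ} {u v : ℝ} (huv : u ≤ v) (hf : ContinuousOn f (Icc u v))
    (hv : 0 ≤ f v) :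
    sInf {x | x ∈ Icc u v ∧ 0 ≤ f x} ∈ Icc u v ∧
      0 ≤ f (sInf {x | x ∈ Icc u v ∧ 0 ≤ f x}) ∧
      (u < sInf {x | x ∈ Icc u v ∧ 0 ≤ f x} → f (sInf {x | x ∈ Icc u v ∧ 0 ≤ f x}) = 0) ∧
      ∀ x ∈ Icc u v, 0 ≤ f x → sInf {x | x ∈ Icc u v ∧ 0 ≤ f x} ≤ x := by
  have hbdd : BddBelow {x | x ∈ Icc u v ∧ 0 ≤ f x} := ⟨u, fun x hx => hx.1.1⟩
  have hclosed : IsClosed {x | x ∈ Icc u v ∧ 0 ≤ f x} :=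
    hf.preimage_isClosed_of_isClosed isClosed_Icc isClosed_Ici
  have hmem := hclosed.csInf_mem ⟨v, ⟨huv, le_rfl⟩, hv⟩ hbdd
  have hle : ∀ x ∈ Icc u v, 0 ≤ f x → sInf {x | x ∈ Icc u v ∧ 0 ≤ f x} ≤ x :=
    fun x hx h => csInf_le hbdd ⟨hx, h⟩
  generalize sInf {x | x ∈ Icc u v ∧ 0 ≤ f x} = t at hmem hle ⊢
  refine ⟨hmem.1, hmem.2, fun hut => ?_, hle⟩
  have hu : f u < 0 := by
    by_contra! h
    exact hut.not_ge (hle u ⟨le_rfl, huv⟩ h)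
  obtain ⟨s, hs, e⟩ := intermediate_value_Icc hut.le (hf.mono (Icc_subset_Icc_right hmem.1.2))
    (show (0 : ℝ) ∈ Icc (f u) (f t) from ⟨hu.le, hmem.2⟩)
  have := hle s ⟨hs.1, hs.2.trans hmem.1.2⟩ e.ge
  rwa [le_antisymm hs.2 this] at e

/-- A function into a compact set is continuous as soon as its composition with a continuous
injection of that set is. -/
theorem continuousOn_of_comp_injOn {f u : ℝ → ℝ} {K S : Set ℝ} (hK : IsCompact K)
    (hf : ContinuousOn f K) (hinj : InjOn f K) (hu : MapsTo u S K)
    (hfu : ContinuousOn (fun x => f (u x)) S) : ContinuousOn u S := by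
  have : CompactSpace K := isCompact_iff_compactSpace.1 hK
  have hemb := (continuousOn_iff_continuous_domRestrict.1 hf).isClosedEmbedding
    (injOn_iff_injective.1 hinj)
  have hc : Continuous (hu.restrict u S K) :=
    hemb.isInducing.continuous_iff.2 (continuousOn_iff_continuous_domRestrict.1 hfu)
  exact continuousOn_iff_continuous_domRestrict.2 (continuous_subtype_val.comp hc)

/-! ### The fourth case: two valleys -/

namespace Model

variable {P : Model}

/-- `g'` has two valleys: it decreases on `[0, a₁]` and `[a, x₀]` and increases on `[a₁, a]` and
`[x₀, ∞)`. -/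
structure TwoValleys (P : Model) : Prop where
  a1_pos : 0 < P.a1
  a1_lt_a : P.a1 < P.a
  a_lt_x0 : P.a < P.x0
  anti₁ : StrictAntiOn P.g' (Icc 0 P.a1)
  mono₂ : StrictMonoOn P.g' (Icc P.a1 P.a)
  anti₃ : StrictAntiOn P.g' (Icc P.a P.x0)
  mono₄ : StrictMonoOn P.g' (Ici P.x0)

theorem CaseIV.twoValleys (hμp : 0 < P.μp) (hμm : 0 < P.μm) (h : P.CaseIV) : P.TwoValleys := by
  obtain ⟨h1, h2, h3, h4, h5, h6⟩ := CaseIV.shape hμp h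
  exact ⟨a1_pos hμm, h1, h2, h3, h4, h5, h6⟩

namespace TwoValleys

/-! ### The branches of `g'` -/

theorem bijOn₂ (H : P.TwoValleys) :
    BijOn P.g' (Icc P.a1 P.a) (Icc (P.g' P.a1) (P.g' P.a)) :=
  ⟨H.mono₂.monotoneOn.mapsTo_Icc, H.mono₂.injOn,
    intermediate_value_Icc H.a1_lt_a.le P.continuous_g'.continuousOn⟩

theorem bijOn₃ (H : P.TwoValleys) :
    BijOn P.g' (Icc P.a P.x0) (Icc (P.g' P.x0) (P.g' P.a)) :=
  ⟨H.anti₃.antitoneOn.mapsTo_Icc, H.anti₃.injOn,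
    intermediate_value_Icc' H.a_lt_x0.le P.continuous_g'.continuousOn⟩

theorem bijOn₄ (H : P.TwoValleys) : BijOn P.g' (Ici P.x0) (Ici (P.g' P.x0)) := by
  refine ⟨fun x hx => H.mono₄.monotoneOn self_mem_Ici hx hx, H.mono₄.injOn, fun y hy => ?_⟩
  obtain ⟨z, hz1, hz2⟩ := ((P.tendsto_g'_atTop.eventually_ge_atTop y).and
    (Filter.eventually_ge_atTop P.x0)).exists
  obtain ⟨s, hs, e⟩ := intermediate_value_Icc hz2 P.continuous_g'.continuousOn ⟨hy, hz1⟩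
  exact ⟨s, hs.1, e⟩

theorem inv2_mem (H : P.TwoValleys) {c : ℝ} (hc : c ∈ Icc (P.g' P.a1) (P.g' P.a)) :
    P.inv2 c ∈ Icc P.a1 P.a := H.bijOn₂.surjOn.mapsTo_invFunOn hc

theorem g'_inv2 (H : P.TwoValleys) {c : ℝ} (hc : c ∈ Icc (P.g' P.a1) (P.g' P.a)) :
    P.g' (P.inv2 c) = c := H.bijOn₂.surjOn.rightInvOn_invFunOn hc

theorem inv2_g' (H : P.TwoValleys) {x : ℝ} (hx : x ∈ Icc P.a1 P.a) : P.inv2 (P.g' x) = x :=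
  H.bijOn₂.injOn.leftInvOn_invFunOn hx

theorem inv3_mem (H : P.TwoValleys) {c : ℝ} (hc : c ∈ Icc (P.g' P.x0) (P.g' P.a)) :
    P.inv3 c ∈ Icc P.a P.x0 := H.bijOn₃.surjOn.mapsTo_invFunOn hc

theorem g'_inv3 (H : P.TwoValleys) {c : ℝ} (hc : c ∈ Icc (P.g' P.x0) (P.g' P.a)) :
    P.g' (P.inv3 c) = c := H.bijOn₃.surjOn.rightInvOn_invFunOn hc

theorem inv3_g' (H : P.TwoValleys) {x : ℝ} (hx : x ∈ Icc P.a P.x0) : P.inv3 (P.g' x) = x :=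
  H.bijOn₃.injOn.leftInvOn_invFunOn hx

theorem inv4_mem (H : P.TwoValleys) {c : ℝ} (hc : P.g' P.x0 ≤ c) : P.x0 ≤ P.inv4 c :=
  H.bijOn₄.surjOn.mapsTo_invFunOn hc

theorem g'_inv4 (H : P.TwoValleys) {c : ℝ} (hc : P.g' P.x0 ≤ c) : P.g' (P.inv4 c) = c :=
  H.bijOn₄.surjOn.rightInvOn_invFunOn hc

theorem g'_a1_lt (H : P.TwoValleys) : P.g' P.a1 < P.g' P.a :=
  H.mono₂ (left_mem_Icc.2 H.a1_lt_a.le) (right_mem_Icc.2 H.a1_lt_a.le) H.a1_lt_a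

theorem g'_x0_lt (H : P.TwoValleys) : P.g' P.x0 < P.g' P.a :=
  H.anti₃ (left_mem_Icc.2 H.a_lt_x0.le) (right_mem_Icc.2 H.a_lt_x0.le) H.a_lt_x0

theorem inv1_spec (H : P.TwoValleys) {c : ℝ} (hc : P.g' P.a1 ≤ c) :
    P.inv1 c ∈ Icc 0 P.a1 ∧ P.g' (P.inv1 c) = min c (P.g' 0) :=
  invL_spec H.anti₁ H.a1_pos.le hc

theorem inv1_mem (H : P.TwoValleys) {c : ℝ} (hc : P.g' P.a1 ≤ c) : P.inv1 c ∈ Icc 0 P.a1 :=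
  (H.inv1_spec hc).1

theorem inv1_g'_a1 (H : P.TwoValleys) : P.inv1 (P.g' P.a1) = P.a1 :=
  invL_eq_of_g'_eq H.anti₁ (right_mem_Icc.2 H.a1_pos.le) (min_eq_left
    (H.anti₁.antitoneOn (left_mem_Icc.2 H.a1_pos.le) (right_mem_Icc.2 H.a1_pos.le)
      H.a1_pos.le)).symm

/-! ### The points `a₅` and `a₆` -/

theorem x0_le_a6 (H : P.TwoValleys) : P.x0 ≤ P.a6 := H.inv4_mem H.g'_x0_lt.le

theorem g'_a6 (H : P.TwoValleys) : P.g' P.a6 = P.g' P.a := H.g'_inv4 H.g'_x0_lt.le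

/-- The maximum appears because the second bottom may be higher than the first, in which case `a5 =
x0`. -/
theorem a5_isLeast (H : P.TwoValleys) : IsLeast {x | P.x0 ≤ x ∧ P.g' P.a1 ≤ P.g' x} P.a5 ∧
    P.g' P.a5 = max (P.g' P.a1) (P.g' P.x0) := by
  obtain ⟨z, hz, e⟩ := H.bijOn₄.surjOn
    (show max (P.g' P.a1) (P.g' P.x0) ∈ Ici (P.g' P.x0) from
      mem_Ici.2 (le_max_right _ _))
  have hl : IsLeast {x | P.x0 ≤ x ∧ P.g' P.a1 ≤ P.g' x} z := by
    refine ⟨⟨hz, e ▸ le_max_left _ _⟩, fun w hw => ?_⟩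
    rw [← H.mono₄.le_iff_le hz hw.1, e]
    exact max_le hw.2 (H.mono₄.monotoneOn self_mem_Ici hw.1 hw.1)
  have : P.a5 = z := hl.csInf_eq
  rw [this]
  exact ⟨hl, e⟩

theorem x0_le_a5 (H : P.TwoValleys) : P.x0 ≤ P.a5 := H.a5_isLeast.1.1.1

theorem g'_a5 (H : P.TwoValleys) : P.g' P.a5 = max (P.g' P.a1) (P.g' P.x0) := H.a5_isLeast.2

theorem a5_le (H : P.TwoValleys) {x : ℝ} (h0 : P.x0 ≤ x) (h1 : P.g' P.a1 ≤ P.g' x) :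
    P.a5 ≤ x := H.a5_isLeast.1.2 ⟨h0, h1⟩

theorem a5_le_a6 (H : P.TwoValleys) : P.a5 ≤ P.a6 :=
  H.a5_le H.x0_le_a6 (H.g'_a6 ▸ H.g'_a1_lt.le)

theorem g'_a1_le (H : P.TwoValleys) {x : ℝ} (hx : P.a5 ≤ x) : P.g' P.a1 ≤ P.g' x :=
  H.a5_isLeast.1.1.2.trans (H.mono₄.monotoneOn H.x0_le_a5 (mem_Ici.2 (H.x0_le_a5.trans hx)) hx)

theorem g'_x0_le (H : P.TwoValleys) {x : ℝ} (hx : P.x0 ≤ x) : P.g' P.x0 ≤ P.g' x :=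
  H.mono₄.monotoneOn self_mem_Ici hx hx

theorem g'_le_a (H : P.TwoValleys) {x : ℝ} (h0 : P.x0 ≤ x) (hx : x ≤ P.a6) :
    P.g' x ≤ P.g' P.a := H.g'_a6 ▸ H.mono₄.monotoneOn h0 H.x0_le_a6 hx

theorem level₃ (H : P.TwoValleys) {x : ℝ} (hx : x ∈ Icc P.x0 P.a6) :
    P.g' x ∈ Icc (P.g' P.x0) (P.g' P.a) := ⟨H.g'_x0_le hx.1, H.g'_le_a hx.1 hx.2⟩

theorem mem_Icc_x0 (H : P.TwoValleys) {x : ℝ} (hx : x ∈ Icc P.a5 P.a6) : x ∈ Icc P.x0 P.a6 :=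
  ⟨H.x0_le_a5.trans hx.1, hx.2⟩

theorem level₂ (H : P.TwoValleys) {x : ℝ} (hx : x ∈ Icc P.a5 P.a6) :
    P.g' x ∈ Icc (P.g' P.a1) (P.g' P.a) :=
  ⟨H.g'_a1_le hx.1, H.g'_le_a (H.mem_Icc_x0 hx).1 hx.2⟩

theorem g'_lt_of_x0_le (H : P.TwoValleys) {x y : ℝ} (hx : P.x0 ≤ x) (h : x < y) :
    P.g' x < P.g' y := H.mono₄ hx (mem_Ici.2 (hx.trans h.le)) h

theorem lt_of_g'_lt (H : P.TwoValleys) {x y : ℝ} (hx : P.x0 ≤ x) (hy : P.x0 ≤ y)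
    (h : P.g' x < P.g' y) : x < y := (H.mono₄.lt_iff_lt hx hy).1 h

theorem a1_le_of_x0_le (H : P.TwoValleys) {x : ℝ} (hx : P.x0 ≤ x) : P.a1 ≤ x :=
  (H.a1_lt_a.trans H.a_lt_x0).le.trans hx

/-! ### The functions whose signs define `x₁` and `x₂` -/

end TwoValleys

/-- The net gain from the first descent to the second one, at level `g' x`. -/
noncomputable def netToDescent (P : Model) (x : ℝ) : ℝ :=
  P.net (P.g' x) (P.inv1 (P.g' x)) (P.inv3 (P.g' x))

/-- The net gain from the first ascent up to `x`, at level `g' x`. -/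
noncomputable def netFromAscent (P : Model) (x : ℝ) : ℝ :=
  P.net (P.g' x) (P.inv2 (P.g' x)) x

/-- The net gain over the second valley, at level `g' x`. -/
noncomputable def netSecond (P : Model) (x : ℝ) : ℝ :=
  P.net (P.g' x) (P.inv3 (P.g' x)) x

theorem x1_eq (P : Model) : P.x1 = sInf {x | x ∈ Icc P.a5 P.a6 ∧ 0 ≤ P.netToDescent x} := by
  simp only [x1, netToDescent, integral_eq_net]

theorem x2_eq (P : Model) : P.x2 = sInf {x | x ∈ Icc P.a5 P.a6 ∧ 0 ≤ P.netFromAscent x} := by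
  simp only [x2, netFromAscent, integral_eq_net]

theorem ω1_eq (P : Model) (x : ℝ) : P.ω1 x = P.φ P.a1 x := rfl

theorem ω1_eq_net (P : Model) (x : ℝ) : P.ω1 x = P.net (P.g' x) (P.inv1 (P.g' x)) x :=
  P.integral_eq_net _ _ _

theorem ω2_of_lt {x : ℝ} (h : x < P.x1) : P.ω2 x = P.netSecond x := by
  rw [ω2, if_pos h, integral_eq_net, netSecond]

theorem ω2_of_ge {x : ℝ} (h : P.x1 ≤ x) : P.ω2 x = P.ω1 x := by
  rw [ω2, if_neg h.not_gt, ω1]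

theorem ω1_eq_netToDescent_add (P : Model) (x : ℝ) :
    P.ω1 x = P.netToDescent x + P.netSecond x := by
  rw [ω1_eq_net, netToDescent, netSecond, net_add]

namespace TwoValleys

theorem ω1_eq_add_netFromAscent (H : P.TwoValleys) {x : ℝ} (hx : x ∈ Icc P.a5 P.a6) :
    P.ω1 x = P.ω1 (P.inv2 (P.g' x)) + P.netFromAscent x := by
  rw [ω1_eq_net, ω1_eq_net, H.g'_inv2 (H.level₂ hx), netFromAscent, net_add]

/-- Raising the level moves both ends left: the piece gained has `g'` below the new level, the piece
lost had `g'` above the old one, and the common part gains. -/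
theorem netToDescent_lt (H : P.TwoValleys) {x y : ℝ} (hx : x ∈ Icc P.a5 P.a6)
    (hy : y ∈ Icc P.a5 P.a6) (h : x < y) : P.netToDescent x < P.netToDescent y := by
  have hc := H.g'_lt_of_x0_le (H.mem_Icc_x0 hx).1 h
  have hx3 := H.level₃ (H.mem_Icc_x0 hx)
  have hy3 := H.level₃ (H.mem_Icc_x0 hy)
  have m3x := H.inv3_mem hx3
  have m3y := H.inv3_mem hy3
  have m1 := H.inv1_mem (H.g'_a1_le hx.1)
  have h3 : P.inv3 (P.g' y) ≤ P.inv3 (P.g' x) := by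
    rw [← H.anti₃.le_iff_ge m3x m3y, H.g'_inv3 hx3, H.g'_inv3 hy3]
    exact hc.le
  have e1 : P.net (P.g' x) (P.inv3 (P.g' y)) (P.inv3 (P.g' x)) ≤ 0 :=
    net_nonpos (P.g'_pos x) h3 fun s hs => by
      rw [← H.g'_inv3 hx3]
      exact H.anti₃.antitoneOn ⟨m3y.1.trans hs.1.le, hs.2.le.trans m3x.2⟩ m3x hs.2.le
  have e2 := net_lt_net (P := P) (P.g'_pos x) hc
    (m1.2.trans_lt (H.a1_lt_a.trans_le m3y.1))
  have e3 : 0 ≤ P.net (P.g' y) (P.inv1 (P.g' y)) (P.inv1 (P.g' x)) :=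
    net_invL_nonneg H.anti₁ H.a1_pos.le (H.g'_a1_le hx.1) hc.le
  rw [netToDescent, netToDescent, ← P.net_add _ _ (P.inv3 (P.g' y)) (P.inv3 (P.g' x)),
    ← P.net_add _ (P.inv1 (P.g' y)) (P.inv1 (P.g' x))]
  linarith

theorem netFromAscent_lt (H : P.TwoValleys) {x y : ℝ} (hx : x ∈ Icc P.a5 P.a6)
    (hy : y ∈ Icc P.a5 P.a6) (h : x < y) : P.netFromAscent x < P.netFromAscent y := by
  have hx0 := (H.mem_Icc_x0 hx).1
  have hc := H.g'_lt_of_x0_le hx0 h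
  have hx2 := H.level₂ hx
  have hy2 := H.level₂ hy
  have m2x := H.inv2_mem hx2
  have m2y := H.inv2_mem hy2
  have h2 : P.inv2 (P.g' x) ≤ P.inv2 (P.g' y) := by
    rw [← H.mono₂.le_iff_le m2x m2y, H.g'_inv2 hx2, H.g'_inv2 hy2]
    exact hc.le
  have e1 : P.net (P.g' x) (P.inv2 (P.g' x)) (P.inv2 (P.g' y)) ≤ 0 :=
    net_nonpos (P.g'_pos x) h2 fun s hs => by
      rw [← H.g'_inv2 hx2]
      exact H.mono₂.monotoneOn m2x ⟨m2x.1.trans hs.1.le, hs.2.le.trans m2y.2⟩ hs.1.le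
  have e2 := net_lt_net (P := P) (P.g'_pos x) hc
    (m2y.2.trans_lt (H.a_lt_x0.trans_le hx0))
  have e3 : 0 ≤ P.net (P.g' y) x y := net_nonneg (P.g'_pos y) h.le fun s hs =>
    (H.g'_lt_of_x0_le (hx0.trans hs.1.le) hs.2).le
  rw [netFromAscent, netFromAscent, ← P.net_add _ (P.inv2 (P.g' x)) (P.inv2 (P.g' y)),
    ← P.net_add _ (P.inv2 (P.g' y)) x y]
  linarith

theorem netSecond_lt (H : P.TwoValleys) {x y : ℝ} (hx : x ∈ Icc P.x0 P.a6)
    (hy : y ∈ Icc P.x0 P.a6) (h : x < y) : P.netSecond x < P.netSecond y := by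
  have hc := H.g'_lt_of_x0_le hx.1 h
  have m3x := H.inv3_mem (H.level₃ hx)
  have m3y := H.inv3_mem (H.level₃ hy)
  have h3 : P.inv3 (P.g' y) ≤ P.inv3 (P.g' x) := by
    rw [← H.anti₃.le_iff_ge m3x m3y, H.g'_inv3 (H.level₃ hx), H.g'_inv3 (H.level₃ hy)]
    exact hc.le
  have e1 : 0 ≤ P.net (P.g' y) (P.inv3 (P.g' y)) (P.inv3 (P.g' x)) :=
    net_nonneg (P.g'_pos y) h3 fun s hs => by
      rw [← H.g'_inv3 (H.level₃ hy)]
      exact H.anti₃.antitoneOn m3y ⟨m3y.1.trans hs.1.le, hs.2.le.trans m3x.2⟩ hs.1.le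
  have e2 := net_le_net (P := P) (P.g'_pos x) hc.le (m3x.2.trans hx.1)
  have e3 : 0 < P.net (P.g' y) x y := net_pos (P.g'_pos y) h fun s hs =>
    H.g'_lt_of_x0_le (hx.1.trans hs.1.le) hs.2
  rw [netSecond, netSecond, ← P.net_add _ (P.inv3 (P.g' y)) (P.inv3 (P.g' x)),
    ← P.net_add _ (P.inv3 (P.g' x)) x y]
  linarith

theorem continuousOn_net {u v : ℝ → ℝ} {S : Set ℝ} (hu : ContinuousOn u S)
    (hv : ContinuousOn v S) : ContinuousOn (fun x => P.net (P.g' x) (u x) (v x)) S :=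
  (hv.sub hu).sub (((P.continuous_g.comp_continuousOn hv).sub
    (P.continuous_g.comp_continuousOn hu)).div P.continuous_g'.continuousOn
      fun x _ => (P.g'_pos x).ne')

theorem continuousOn_netToDescent (H : P.TwoValleys) :
    ContinuousOn P.netToDescent (Icc P.a5 P.a6) := by
  have hg := P.continuous_g'
  refine continuousOn_net
    (continuousOn_of_comp_injOn (K := Icc 0 P.a1) isCompact_Icc hg.continuousOn H.anti₁.injOn
      (fun x hx => H.inv1_mem (H.g'_a1_le hx.1)) ?_)
    (continuousOn_of_comp_injOn (K := Icc P.a P.x0) isCompact_Icc hg.continuousOn H.anti₃.injOn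
      (fun x hx => H.inv3_mem (H.level₃ (H.mem_Icc_x0 hx))) ?_)
  · exact ContinuousOn.congr (f := fun x => min (P.g' x) (P.g' 0)) (by fun_prop)
      fun x hx => (H.inv1_spec (H.g'_a1_le hx.1)).2
  · exact hg.continuousOn.congr fun x hx => H.g'_inv3 (H.level₃ (H.mem_Icc_x0 hx))

theorem continuousOn_netFromAscent (H : P.TwoValleys) :
    ContinuousOn P.netFromAscent (Icc P.a5 P.a6) := by
  have hg := P.continuous_g'
  refine continuousOn_net
    (continuousOn_of_comp_injOn (K := Icc P.a1 P.a) isCompact_Icc hg.continuousOn H.mono₂.injOn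
      (fun x hx => H.inv2_mem (H.level₂ hx)) ?_) continuousOn_id
  exact hg.continuousOn.congr fun x hx => H.g'_inv2 (H.level₂ hx)

theorem netToDescent_a6_nonneg (H : P.TwoValleys) : 0 ≤ P.netToDescent P.a6 := by
  rw [netToDescent, H.g'_a6, H.inv3_g' (left_mem_Icc.2 H.a_lt_x0.le)]
  have h1 := H.inv1_mem H.g'_a1_lt.le
  refine net_nonneg (P.g'_pos _) (h1.2.trans H.a1_lt_a.le) fun s hs => ?_
  rcases le_total s P.a1 with h | h
  · exact g'_le_of_invL_le H.anti₁ H.a1_pos.le H.g'_a1_lt.le hs.1.le h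
  · exact H.mono₂.monotoneOn ⟨h, hs.2.le⟩ (right_mem_Icc.2 H.a1_lt_a.le) hs.2.le

theorem netFromAscent_a6_nonneg (H : P.TwoValleys) : 0 ≤ P.netFromAscent P.a6 := by
  rw [netFromAscent, H.g'_a6, H.inv2_g' (right_mem_Icc.2 H.a1_lt_a.le)]
  refine net_nonneg (P.g'_pos _) (H.a_lt_x0.le.trans H.x0_le_a6) fun s hs => ?_
  rcases le_total s P.x0 with h | h
  · exact H.anti₃.antitoneOn (left_mem_Icc.2 H.a_lt_x0.le) ⟨hs.1.le, h⟩ hs.1.le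
  · exact H.g'_le_a h hs.2.le

/-! ### The points `x₁` and `x₂` -/

theorem x1_mem (H : P.TwoValleys) : P.x1 ∈ Icc P.a5 P.a6 :=
  P.x1_eq ▸ (sInf_nonneg_spec H.a5_le_a6 H.continuousOn_netToDescent H.netToDescent_a6_nonneg).1

theorem x1_nonneg (H : P.TwoValleys) : 0 ≤ P.netToDescent P.x1 :=
  P.x1_eq ▸ (sInf_nonneg_spec H.a5_le_a6 H.continuousOn_netToDescent
    H.netToDescent_a6_nonneg).2.1

/-- The infimum is a zero unless `x1 = a5`. In that case `x1 > x0` forces the level `g' a1`, above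
which `g'` stays between `a1` and the second descent, so the net gain would be negative. -/
theorem x1_eq_zero (H : P.TwoValleys) (h : P.x0 < P.x1) : P.netToDescent P.x1 = 0 := by
  have hspec := (sInf_nonneg_spec H.a5_le_a6 H.continuousOn_netToDescent
    H.netToDescent_a6_nonneg).2.2.1
  rw [← x1_eq] at hspec
  rcases H.x1_mem.1.lt_or_eq with h5 | h5
  · exact hspec h5
  · exfalso
    have hlev : P.g' P.x1 = P.g' P.a1 := by
      have h1 := H.g'_lt_of_x0_le le_rfl h
      have h2 := H.g'_a5
      rw [h5] at h2
      rcases max_cases (P.g' P.a1) (P.g' P.x0) with ⟨e, -⟩ | ⟨e, -⟩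
      · rw [h2, e]
      · exact absurd (h2.trans e) h1.ne'
    have h3 := H.level₃ (H.mem_Icc_x0 H.x1_mem)
    have m3 := H.inv3_mem h3
    have hneg : P.netToDescent P.x1 < 0 := by
      have hlt : P.a1 < P.inv3 (P.g' P.x1) := H.a1_lt_a.trans_le m3.1
      rw [netToDescent, hlev, H.inv1_g'_a1, ← hlev]
      refine net_neg (P.g'_pos _) hlt fun s hs => ?_
      rcases le_total s P.a with hsa | hsa
      · rw [hlev]
        exact H.mono₂ (left_mem_Icc.2 H.a1_lt_a.le) ⟨hs.1.le, hsa⟩ hs.1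
      · rw [← H.g'_inv3 h3]
        exact H.anti₃ ⟨hsa, hs.2.le.trans m3.2⟩ m3 hs.2
    exact hneg.not_ge H.x1_nonneg

theorem x2_mem (H : P.TwoValleys) : P.x2 ∈ Icc P.a5 P.a6 :=
  P.x2_eq ▸ (sInf_nonneg_spec H.a5_le_a6 H.continuousOn_netFromAscent
    H.netFromAscent_a6_nonneg).1

theorem x2_nonneg (H : P.TwoValleys) : 0 ≤ P.netFromAscent P.x2 :=
  P.x2_eq ▸ (sInf_nonneg_spec H.a5_le_a6 H.continuousOn_netFromAscent
    H.netFromAscent_a6_nonneg).2.1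

theorem x2_eq_zero (H : P.TwoValleys) (h : P.a5 < P.x2) : P.netFromAscent P.x2 = 0 := by
  have hspec := (sInf_nonneg_spec H.a5_le_a6 H.continuousOn_netFromAscent
    H.netFromAscent_a6_nonneg).2.2.1
  rw [← x2_eq] at hspec
  exact hspec h

theorem x2_le (H : P.TwoValleys) {x : ℝ} (hx : x ∈ Icc P.a5 P.a6) (h : 0 ≤ P.netFromAscent x) :
    P.x2 ≤ x :=
  P.x2_eq ▸ (sInf_nonneg_spec H.a5_le_a6 H.continuousOn_netFromAscent
    H.netFromAscent_a6_nonneg).2.2.2 x hx h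

/-- If `x₂ = a₅`, then its level is that of the bottom of the first valley. -/
theorem g'_x2_of_eq_a5 (H : P.TwoValleys) (h : P.x2 = P.a5) : P.g' P.x2 = P.g' P.a1 := by
  by_contra hne
  have h5 := H.g'_a5
  rw [← h] at h5
  have hlev : P.g' P.x2 = P.g' P.x0 := by
    rcases max_cases (P.g' P.a1) (P.g' P.x0) with ⟨e, -⟩ | ⟨e, -⟩
    · exact absurd (h5.trans e) hne
    · rw [h5, e]
  have hx : P.x2 = P.x0 := H.mono₄.injOn (H.mem_Icc_x0 H.x2_mem).1 self_mem_Ici hlev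
  have h2 := H.level₂ H.x2_mem
  have m2 := H.inv2_mem h2
  -- If the level were that of the second bottom, `g'` would exceed it all the way from the first
  -- ascent to `x0`.
  have hneg : P.netFromAscent P.x2 < 0 := by
    refine net_neg (P.g'_pos _) (m2.2.trans_lt (H.a_lt_x0.trans_le hx.ge)) fun s hs => ?_
    rcases le_total s P.a with hsa | hsa
    · rw [← H.g'_inv2 h2]
      exact H.mono₂ m2 ⟨m2.1.trans hs.1.le, hsa⟩ hs.1
    · rw [hlev]
      have hs2 : s < P.x0 := hx ▸ hs.2
      exact H.anti₃ ⟨hsa, hs2.le⟩ (right_mem_Icc.2 H.a_lt_x0.le) hs2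
  exact hneg.not_ge H.x2_nonneg

/-! ### Monotonicity of `ω₁` and `ω₂` -/

theorem ω1_lt_left (H : P.TwoValleys) : StrictMonoOn P.ω1 (Icc P.a1 P.a) := by
  intro x hx y hy hxy
  rw [ω1_eq, ω1_eq]
  exact φ_lt_φ H.anti₁ H.a1_pos.le hx.1
    (H.mono₂.monotoneOn (left_mem_Icc.2 H.a1_lt_a.le) hx hx.1) hxy
    fun s hs => H.mono₂ ⟨hx.1.trans hs.1, hs.2.le.trans hy.2⟩ hy hs.2

theorem ω1_lt_right (H : P.TwoValleys) : StrictMonoOn P.ω1 (Ici P.a5) := by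
  intro x hx y hy hxy
  have hx0 : P.x0 ≤ x := H.x0_le_a5.trans hx
  rw [ω1_eq, ω1_eq]
  exact φ_lt_φ H.anti₁ H.a1_pos.le (H.a1_le_of_x0_le hx0) (H.g'_a1_le hx) hxy
    fun s hs => H.g'_lt_of_x0_le (hx0.trans hs.1) hs.2

theorem inv2_x2_mem (H : P.TwoValleys) : P.inv2 (P.g' P.x2) ∈ Icc P.a1 P.a :=
  H.inv2_mem (H.level₂ H.x2_mem)

theorem g'_inv2_x2 (H : P.TwoValleys) : P.g' (P.inv2 (P.g' P.x2)) = P.g' P.x2 :=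
  H.g'_inv2 (H.level₂ H.x2_mem)

theorem mem_left_of_le (H : P.TwoValleys) {y : ℝ} (hy : y ∈ Icc P.a1 (P.inv2 (P.g' P.x2))) :
    y ∈ Icc P.a1 P.a := ⟨hy.1, hy.2.trans H.inv2_x2_mem.2⟩

theorem g'_le_x2 (H : P.TwoValleys) {y : ℝ} (hy : y ∈ Icc P.a1 (P.inv2 (P.g' P.x2))) :
    P.g' y ≤ P.g' P.x2 :=
  H.g'_inv2_x2 ▸ H.mono₂.monotoneOn (H.mem_left_of_le hy) H.inv2_x2_mem hy.2

theorem x2_le_g' (H : P.TwoValleys) {y : ℝ} (hy : P.x2 ≤ y) : P.g' P.x2 ≤ P.g' y :=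
  H.mono₄.monotoneOn (H.mem_Icc_x0 H.x2_mem).1 (mem_Ici.2 ((H.mem_Icc_x0 H.x2_mem).1.trans hy)) hy

theorem ω1_inv2_x2_le (H : P.TwoValleys) : P.ω1 (P.inv2 (P.g' P.x2)) ≤ P.ω1 P.x2 := by
  rw [H.ω1_eq_add_netFromAscent H.x2_mem]
  linarith [H.x2_nonneg]

/-- On its domain `ω₁` is a strictly increasing function of the level `g'`. -/
theorem ω1_lt_of_g'_lt (H : P.TwoValleys) {x y : ℝ} (hx : x ∈ P.domω1) (hy : y ∈ P.domω1)
    (h : P.g' x < P.g' y) : P.ω1 x < P.ω1 y := by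
  have h5 := H.x2_mem.1
  rcases hx with hx | hx <;> rcases hy with hy | hy
  · have mx := H.mem_left_of_le hx
    have my := H.mem_left_of_le hy
    exact H.ω1_lt_left mx my ((H.mono₂.lt_iff_lt mx my).1 h)
  · have mx := H.mem_left_of_le hx
    have e1 := H.ω1_lt_left.monotoneOn mx H.inv2_x2_mem hx.2
    have e2 := H.ω1_inv2_x2_le
    have e3 := H.ω1_lt_right.monotoneOn h5 (mem_Ici.2 (h5.trans hy)) hy
    -- Equality would force `x` and `y` to be the two edges of the gap in the domain, which share
    -- one level.
    refine lt_of_le_of_ne (by linarith) fun e => ?_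
    have e4 : x = P.inv2 (P.g' P.x2) := H.ω1_lt_left.injOn mx H.inv2_x2_mem (by linarith)
    have e5 : P.x2 = y := H.ω1_lt_right.injOn h5 (mem_Ici.2 (h5.trans hy)) (by linarith)
    rw [e4, H.g'_inv2_x2, e5] at h
    exact h.false
  · exact absurd h ((H.g'_le_x2 hy).trans (H.x2_le_g' hx)).not_gt
  · have hx0 := (H.mem_Icc_x0 H.x2_mem).1
    exact H.ω1_lt_right (mem_Ici.2 (h5.trans hx)) (mem_Ici.2 (h5.trans hy))
      (H.lt_of_g'_lt (hx0.trans hx) (hx0.trans hy) h)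

theorem g'_eq_of_mem_ω1inv (H : P.TwoValleys) {b x y : ℝ} (hx : x ∈ P.ω1inv b)
    (hy : y ∈ P.ω1inv b) : P.g' x = P.g' y := by
  by_contra hne
  rcases lt_or_gt_of_ne hne with h | h
  · exact (H.ω1_lt_of_g'_lt hx.1 hy.1 h).ne (hx.2.trans hy.2.symm)
  · exact (H.ω1_lt_of_g'_lt hy.1 hx.1 h).ne (hy.2.trans hx.2.symm)

theorem eq_of_g'_eq_x2 (H : P.TwoValleys) {y : ℝ} (hy : y ∈ P.domω1) (e : P.g' y = P.g' P.x2) :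
    y = P.inv2 (P.g' P.x2) ∨ y = P.x2 := by
  have hx0 := (H.mem_Icc_x0 H.x2_mem).1
  rcases hy with hy | hy
  · exact Or.inl (by rw [← e, H.inv2_g' (H.mem_left_of_le hy)])
  · exact Or.inr (H.mono₄.injOn (mem_Ici.2 (hx0.trans hy)) hx0 e)

theorem x2_mem_domω1 (P : Model) : P.x2 ∈ P.domω1 := Or.inr self_mem_Ici

theorem ω1inv_subset_of_eq (H : P.TwoValleys) {b : ℝ} (hb : b = P.ω1 P.x2) :
    P.ω1inv b ⊆ {P.inv2 (P.g' P.x2), P.x2} := fun _ hy =>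
  H.eq_of_g'_eq_x2 hy.1 (H.g'_eq_of_mem_ω1inv hy ⟨x2_mem_domω1 P, hb.symm⟩)

theorem ω1inv_subsingleton (H : P.TwoValleys) {b : ℝ} (hb : b ≠ P.ω1 P.x2) :
    (P.ω1inv b).Subsingleton := by
  have hx0 := (H.mem_Icc_x0 H.x2_mem).1
  have key : ∀ x ∈ P.ω1inv b, ∀ y ∈ P.ω1inv b, x ∈ Icc P.a1 (P.inv2 (P.g' P.x2)) →
      P.x2 ≤ y → False := by
    intro x hx y hy hx1 hy1
    have e := H.g'_eq_of_mem_ω1inv hx hy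
    have e2 : P.g' y = P.g' P.x2 := le_antisymm (e ▸ H.g'_le_x2 hx1) (H.x2_le_g' hy1)
    have e3 : y = P.x2 := H.mono₄.injOn (mem_Ici.2 (hx0.trans hy1)) hx0 e2
    exact hb (e3 ▸ hy.2.symm)
  intro x hx y hy
  have e := H.g'_eq_of_mem_ω1inv hx hy
  rcases hx.1 with hx1 | hx1 <;> rcases hy.1 with hy1 | hy1
  · exact H.mono₂.injOn (H.mem_left_of_le hx1) (H.mem_left_of_le hy1) e
  · exact (key x hx y hy hx1 hy1).elim
  · exact (key y hy x hx hy1 hx1).elim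
  · exact H.mono₄.injOn (mem_Ici.2 (hx0.trans hx1)) (mem_Ici.2 (hx0.trans hy1)) e

/-- For `x2 > a5` the net gain across the gap in the domain is zero, so `ω1` agrees at its two
edges. -/
theorem ω1inv_eq_pair (H : P.TwoValleys) {b : ℝ} (hb : b = P.ω1 P.x2) (h : P.a5 < P.x2) :
    P.ω1inv b = {P.inv2 (P.g' P.x2), P.x2} := by
  refine (H.ω1inv_subset_of_eq hb).antisymm ?_
  rintro y (rfl | rfl)
  · refine ⟨Or.inl ⟨H.inv2_x2_mem.1, le_rfl⟩, ?_⟩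
    rw [hb, H.ω1_eq_add_netFromAscent H.x2_mem, H.x2_eq_zero h, add_zero]
  · exact ⟨x2_mem_domω1 P, hb.symm⟩

theorem ω1_a1 (H : P.TwoValleys) : P.ω1 P.a1 = 0 := by
  rw [ω1_eq, φ_self H.anti₁ H.a1_pos.le]

/-- For `x2 = a5` the left edge of the gap is `a1`, where `ω1` vanishes. -/
theorem ω1inv_eq_singleton (H : P.TwoValleys) {b : ℝ} (hb0 : 0 < b) (hb : b = P.ω1 P.x2)
    (h : P.x2 = P.a5) : P.ω1inv b = {P.x2} := by
  refine Subset.antisymm (fun y hy => ?_) ?_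
  · rcases H.ω1inv_subset_of_eq hb hy with e | e
    · rw [H.g'_x2_of_eq_a5 h, H.inv2_g' (left_mem_Icc.2 H.a1_lt_a.le)] at e
      have := hy.2
      rw [e, H.ω1_a1] at this
      exact absurd this hb0.ne
    · exact e
  · rintro y rfl
    exact ⟨x2_mem_domω1 P, hb.symm⟩

/-- At `x1` the definition switches from `netSecond` to `netToDescent + netSecond`, and
`netToDescent` is nonnegative there. -/
theorem strictMonoOn_ω2 (H : P.TwoValleys) : StrictMonoOn P.ω2 (Ici P.x0) := by
  intro x hx y hy hxy
  have h6 := H.x1_mem.2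
  rcases lt_or_ge y P.x1 with h1 | h1
  · rw [ω2_of_lt h1, ω2_of_lt (hxy.trans h1)]
    exact H.netSecond_lt ⟨hx, ((hxy.trans h1).trans_le h6).le⟩ ⟨hy, (h1.trans_le h6).le⟩ hxy
  · rw [ω2_of_ge h1]
    have h5 := H.x1_mem.1
    rcases lt_or_ge x P.x1 with h2 | h2
    · rw [ω2_of_lt h2]
      have e1 := H.netSecond_lt ⟨hx, (h2.trans_le h6).le⟩ (H.mem_Icc_x0 H.x1_mem) h2
      have e2 := P.ω1_eq_netToDescent_add P.x1
      have e3 := H.x1_nonneg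
      have e4 := H.ω1_lt_right.monotoneOn h5 (mem_Ici.2 (h5.trans h1)) h1
      linarith
    · rw [ω2_of_ge h2]
      exact H.ω1_lt_right (mem_Ici.2 (h5.trans h2)) (mem_Ici.2 (h5.trans h1)) hxy

theorem ω2inv_subsingleton (H : P.TwoValleys) (b : ℝ) : (P.ω2inv b).Subsingleton :=
  fun _ hx _ hy => H.strictMonoOn_ω2.injOn hx.1 hy.1 (hx.2.trans hy.2.symm)

/-! ### Maximizers in the presence of two valleys -/

theorem a1_le_of_mem_domω1 (H : P.TwoValleys) {y : ℝ} (hy : y ∈ P.domω1) :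
    P.a1 ≤ y ∧ P.g' P.a1 ≤ P.g' y := by
  rcases hy with hy | hy
  · exact ⟨hy.1, H.mono₂.monotoneOn (left_mem_Icc.2 H.a1_lt_a.le) (H.mem_left_of_le hy) hy.1⟩
  · exact ⟨H.a1_le_of_x0_le ((H.mem_Icc_x0 H.x2_mem).1.trans hy), H.g'_a1_le (H.x2_mem.1.trans hy)⟩

variable {β c : ℝ}

/-- Each such point carries an interval of net gain `β` at its own level, and `c` is the least level
at which this can happen. -/
theorem le_g'_of_mem_ω1inv (H : P.TwoValleys) (hc : P.IsOptimalLevel β c) (hβ : 0 < β) {y : ℝ}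
    (hy : y ∈ P.ω1inv β) : c ≤ P.g' y := by
  obtain ⟨h1, h2⟩ := H.a1_le_of_mem_domω1 hy.1
  have m1 := H.inv1_mem h2
  exact hc.le_of_net_eq hβ (P.g'_pos y) m1.1 (m1.2.trans h1) ((P.ω1_eq_net y).symm.trans hy.2)

theorem le_g'_of_mem_ω2inv (H : P.TwoValleys) (hc : P.IsOptimalLevel β c) (hβ : 0 < β) {w : ℝ}
    (hw : w ∈ P.ω2inv β) : c ≤ P.g' w := by
  rcases lt_or_ge w P.x1 with h | h
  · have m3 := H.inv3_mem (H.level₃ ⟨hw.1, (h.trans_le H.x1_mem.2).le⟩)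
    exact hc.le_of_net_eq hβ (P.g'_pos w) (P.a_pos.le.trans m3.1) (m3.2.trans hw.1)
      ((ω2_of_lt h).symm.trans hw.2)
  · have m1 := H.inv1_mem (H.g'_a1_le (H.x1_mem.1.trans h))
    exact hc.le_of_net_eq hβ (P.g'_pos w) m1.1 (m1.2.trans (H.a1_le_of_x0_le hw.1))
      ((P.ω1_eq_net w).symm.trans ((ω2_of_ge h).symm.trans hw.2))

theorem inv1_mem_M (H : P.TwoValleys) (hc : P.IsOptimalLevel β c) {y : ℝ} (h1 : P.a1 ≤ y)
    (h2 : P.g' P.a1 ≤ P.g' y) (hω : P.ω1 y = β) (e : P.g' y = c) :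
    (P.inv1 (P.g' y), y) ∈ P.M β := by
  have m1 := H.inv1_mem h2
  exact (hc.mem_M _ _).2 ⟨m1.1, m1.2.trans h1, by rw [← hω, ω1_eq_net, e]⟩

theorem zTilde_subset_M (H : P.TwoValleys) (hc : P.IsOptimalLevel β c) {y : ℝ}
    (hy : y ∈ P.ω1inv β) (e : P.g' y = c) : P.zTilde β ⊆ P.M β := by
  rintro _ ⟨x, hx, rfl⟩
  obtain ⟨h1, h2⟩ := H.a1_le_of_mem_domω1 hx.1
  exact H.inv1_mem_M hc h1 h2 hx.2 ((H.g'_eq_of_mem_ω1inv hx hy).trans e)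

/-- A maximizer comes from `ω₁`, or from `ω₂` at a point not beyond `x₁`. -/
theorem mem_M_cases (H : P.TwoValleys) (hc : P.IsOptimalLevel β c) (hβ : 0 < β) {z : ℝ × ℝ}
    (hz : z ∈ P.M β) :
    (z ∈ P.zTilde β ∧ ∃ y ∈ P.ω1inv β, P.g' y = c) ∨
      (z ∈ P.zBar β ∧ z.2 ∈ P.ω2inv β ∧ P.g' z.2 = c ∧ z.2 ≤ P.x1) := by
  obtain ⟨x, y⟩ := z
  obtain ⟨hx0, hxy, e⟩ := (hc.mem_M x y).1 hz
  have hgy := hc.g'_right hβ hz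
  have hy1 : P.a1 ≤ y := by
    by_contra! hlt
    exact hc.not_strictAntiOn_right hβ hz hlt
      (H.anti₁.mono (Icc_subset_Icc_left (hx0.trans hxy)))
  have hy2 : P.a ≤ y → P.x0 ≤ y := by
    intro h
    by_contra! hlt
    exact hc.not_strictAntiOn_right hβ hz hlt (H.anti₃.mono (Icc_subset_Icc_left h))
  rcases le_or_gt x P.a1 with hx1 | hx1
  · left
    have hinv : P.inv1 c = x := hc.left_eq_invL hβ hz H.anti₁ hx1
    have hlow : P.g' P.a1 ≤ c :=
      (H.anti₁.antitoneOn ⟨hx0, hx1⟩ (right_mem_Icc.2 H.a1_pos.le) hx1).trans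
        (hc.g'_left_le hβ hz)
    have hdom : y ∈ P.domω1 := by
      rcases lt_or_ge y P.a with hya | hya
      · left
        refine ⟨hy1, ?_⟩
        -- Beyond the left edge of the gap the level exceeds `g' x2`, so extending the interval to
        -- the second ascent would gain.
        by_contra! hlt
        have my : y ∈ Icc P.a1 P.a := ⟨hy1, hya.le⟩
        have hlev : P.g' P.x2 < c := by
          rw [← hgy, ← H.g'_inv2_x2]
          exact H.mono₂ H.inv2_x2_mem my hlt
        have hca : c < P.g' P.a := hgy ▸ H.mono₂ my (right_mem_Icc.2 H.a1_lt_a.le) hya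
        have hx20 := (H.mem_Icc_x0 H.x2_mem).1
        have hc0 : P.g' P.x0 ≤ c := (H.g'_x0_le hx20).trans hlev.le
        have m4 := H.inv4_mem hc0
        have e4 := H.g'_inv4 hc0
        have h4 : P.x2 < P.inv4 c := H.lt_of_g'_lt hx20 m4 (e4.symm ▸ hlev)
        have h46 : P.inv4 c ≤ P.a6 :=
          (H.lt_of_g'_lt m4 H.x0_le_a6 (by rw [e4, H.g'_a6]; exact hca)).le
        have hpos := H.x2_nonneg.trans_lt
          (H.netFromAscent_lt H.x2_mem ⟨H.x2_mem.1.trans h4.le, h46⟩ h4)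
        have hy' : P.inv2 c = y := by rw [← hgy, H.inv2_g' my]
        rw [netFromAscent, e4, hy'] at hpos
        exact hpos.not_ge (hc.net_right_nonpos hz (hya.le.trans (H.a_lt_x0.le.trans m4)))
      · right
        have hyx := hy2 hya
        rcases le_total P.a6 y with h6 | h6
        · exact H.x2_mem.2.trans h6
        · have my : y ∈ Icc P.a5 P.a6 := ⟨H.a5_le hyx (hgy.symm ▸ hlow), h6⟩
          -- An optimal interval has nonnegative suffixes; the suffix from the first ascent is the
          -- quantity whose sign defines `x2`.
          refine H.x2_le my ?_
          rw [netFromAscent, hgy]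
          have m2 := H.inv2_mem (H.level₂ my)
          rw [hgy] at m2
          exact hc.net_suffix_nonneg hz (hx1.trans m2.1)
    have hω : P.ω1 y = β := by rw [ω1_eq_net, hgy, hinv, e]
    exact ⟨⟨y, ⟨hdom, hω⟩, by simp only [hgy, hinv]⟩, y, ⟨hdom, hω⟩, hgy⟩
  · right
    have hxa : P.a < x := by
      by_contra! hle
      exact hc.not_strictMonoOn_left hβ hz H.a1_pos.le hx1
        (H.mono₂.mono (Icc_subset_Icc_right hle))
    have hxx0 : x ≤ P.x0 := by
      by_contra! hlt
      exact hc.not_strictMonoOn_left hβ hz (P.a_pos.trans H.a_lt_x0).le hlt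
        (H.mono₄.mono Icc_subset_Ici_self)
    have hyx := hy2 (hxa.le.trans hxy)
    have hgx := hc.g'_left hβ hz (P.a_pos.trans hxa)
    have hinv : P.inv3 c = x := by rw [← hgx, H.inv3_g' ⟨hxa.le, hxx0⟩]
    have hca : c < P.g' P.a :=
      hgx ▸ H.anti₃ (left_mem_Icc.2 H.a_lt_x0.le) ⟨hxa.le, hxx0⟩ hxa
    have h6 : y ≤ P.a6 :=
      (H.lt_of_g'_lt hyx H.x0_le_a6 (by rw [hgy, H.g'_a6]; exact hca)).le
    have hsec : P.netSecond y = β := by rw [netSecond, hgy, hinv, e]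
    -- Prepending the stretch from the first descent must not gain, whereas past `x1` it would gain
    -- strictly; only `y = x1`, with zero gain, survives.
    have hge : P.x1 ≤ y → P.netToDescent y = 0 ∧ y = P.x1 := by
      intro h
      have my : y ∈ Icc P.a5 P.a6 := ⟨H.x1_mem.1.trans h, h6⟩
      have hle : P.netToDescent y ≤ 0 := by
        have m1 := H.inv1_mem (H.g'_a1_le my.1)
        rw [hgy] at m1
        rw [netToDescent, hgy, hinv]
        exact hc.net_left_nonpos hz m1.1 (m1.2.trans hx1.le)
      have heq : y = P.x1 := by
        by_contra hne
        have := H.netToDescent_lt H.x1_mem my (lt_of_le_of_ne h (Ne.symm hne))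
        linarith [H.x1_nonneg]
      exact ⟨le_antisymm hle (heq ▸ H.x1_nonneg), heq⟩
    have hω : P.ω2 y = β := by
      rcases lt_or_ge y P.x1 with h | h
      · rw [ω2_of_lt h, hsec]
      · rw [ω2_of_ge h, ω1_eq_netToDescent_add, (hge h).1, hsec, zero_add]
    refine ⟨⟨y, ⟨hyx, hω⟩, by simp only [hgy, hinv]⟩, ⟨hyx, hω⟩, hgy, ?_⟩
    rcases le_total y P.x1 with h | h
    · exact h
    · exact (hge h).2.le

theorem M_eq_zTilde (H : P.TwoValleys) (hc : P.IsOptimalLevel β c) (hβ : 0 < β)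
    (h : ∀ w ∈ P.ω2inv β, P.g' w = c → ¬ w ≤ P.x1) :
    (∃ y ∈ P.ω1inv β, P.g' y = c) ∧ P.M β = P.zTilde β := by
  have key : ∀ z ∈ P.M β, z ∈ P.zTilde β ∧ ∃ y ∈ P.ω1inv β, P.g' y = c := by
    intro z hz
    rcases H.mem_M_cases hc hβ hz with h1 | ⟨-, h2, h3, h4⟩
    · exact h1
    · exact absurd h4 (h _ h2 h3)
  obtain ⟨z, hz⟩ := P.M_nonempty hβ
  obtain ⟨-, y, hy, e⟩ := key z hz
  exact ⟨⟨y, hy, e⟩, Subset.antisymm (fun z hz => (key z hz).1) (H.zTilde_subset_M hc hy e)⟩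

/-- Since `ω2` increases, `β > ω2 x1` puts its preimage past `x1`, where no maximizer starts on the
second descent. -/
theorem M_eq_zTilde_of_mem_A3 (H : P.TwoValleys) (hc : P.IsOptimalLevel β c) (hβ : 0 < β)
    (h : β ∈ P.A3) : (∃ y ∈ P.ω1inv β, P.g' y = c) ∧ P.M β = P.zTilde β := by
  refine H.M_eq_zTilde hc hβ fun w hw _ hle => ?_
  have := H.strictMonoOn_ω2.monotoneOn hw.1 (H.mem_Icc_x0 H.x1_mem).1 hle
  rw [hw.2] at this
  exact this.not_gt h

theorem M_eq_zTilde_of_mem_A1 (H : P.TwoValleys) (hc : P.IsOptimalLevel β c) (hβ : 0 < β)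
    (h : β ∈ P.A1) : (∃ y ∈ P.ω1inv β, P.g' y = c) ∧ P.M β = P.zTilde β := by
  obtain ⟨-, y, hy, hlt⟩ := h
  exact H.M_eq_zTilde hc hβ fun w hw e _ =>
    (H.le_g'_of_mem_ω1inv hc hβ hy).not_gt (e ▸ hlt w hw)

theorem M_eq_zBar_of_mem_A2 (H : P.TwoValleys) (hc : P.IsOptimalLevel β c) (hβ : 0 < β)
    (h : β ∈ P.A2) : P.M β = P.zBar β := by
  obtain ⟨-, w, hw, hlt⟩ := h
  have hsub : P.M β ⊆ P.zBar β := by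
    intro z hz
    rcases H.mem_M_cases hc hβ hz with ⟨-, y, hy, e⟩ | h2
    · exact absurd (e ▸ hlt y hy) (H.le_g'_of_mem_ω2inv hc hβ hw).not_gt
    · exact h2.1
  have hss : (P.zBar β).Subsingleton := (H.ω2inv_subsingleton β).image _
  obtain ⟨z, hz⟩ := P.M_nonempty hβ
  exact hsub.antisymm fun z' hz' => hss (hsub hz) hz' ▸ hz

/-- On `A3` the optimal level is attained on `ω1inv`; membership in `A2` would produce a level
strictly below it. -/
theorem A2_inter_A3 (H : P.TwoValleys) : P.A2 ∩ P.A3 = ∅ := by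
  refine eq_empty_of_forall_notMem fun b hb => ?_
  have hb0 : 0 < b := hb.1.1
  obtain ⟨c, hc⟩ := P.exists_isOptimalLevel hb0
  obtain ⟨⟨y, hy, e⟩, -⟩ := H.M_eq_zTilde_of_mem_A3 hc hb0 hb.2
  obtain ⟨-, w, hw, hlt⟩ := hb.1
  exact (H.le_g'_of_mem_ω2inv hc hb0 hw).not_gt (e ▸ hlt y hy)

theorem zBar_subset_M (H : P.TwoValleys) (hc : P.IsOptimalLevel β c) (hβ : 0 < β) {w : ℝ}
    (hw : w ∈ P.ω2inv β) (e : P.g' w = c) (h3 : β ∉ P.A3) : P.zBar β ⊆ P.M β := by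
  rintro _ ⟨v, hv, rfl⟩
  obtain rfl := H.ω2inv_subsingleton β hv hw
  have hx10 := (H.mem_Icc_x0 H.x1_mem).1
  have hle : v ≤ P.x1 := by
    rw [← H.strictMonoOn_ω2.le_iff_le hw.1 hx10, hw.2]
    exact not_lt.1 h3
  have m3 := H.inv3_mem (H.level₃ ⟨hw.1, hle.trans H.x1_mem.2⟩)
  have hsec : P.netSecond v = β := by
    rcases hle.lt_or_eq with h | h
    · rw [← ω2_of_lt h, hw.2]
    -- At `v = x1` the value of `ω2` is that of `ω1`, so `netToDescent` must be shown to vanish.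
    -- This holds for `x1 > x0`; for `x1 = x0` an optimal interval would end with the descent to
    -- `x0`.
    · have hω : P.ω1 v = β := by rw [← ω2_of_ge h.ge, hw.2]
      have hM := H.inv1_mem_M hc (H.a1_le_of_x0_le hw.1)
        (H.g'_a1_le (H.x1_mem.1.trans h.ge)) hω e
      have hlt : P.x0 < P.x1 := by
        refine hx10.lt_of_ne fun h0 => ?_
        refine hc.not_strictAntiOn_left hβ hM (w := P.a) (H.a_lt_x0.trans_le hw.1) ?_
        rw [h, ← h0]
        exact H.anti₃
      have h0 := H.x1_eq_zero hlt
      rw [← h] at h0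
      rw [← hω, ω1_eq_netToDescent_add, h0, zero_add]
  exact (hc.mem_M _ _).2 ⟨P.a_pos.le.trans m3.1, m3.2.trans hw.1, by
    rw [← hsec, netSecond, e]⟩

theorem M_eq_union (H : P.TwoValleys) (hc : P.IsOptimalLevel β c) (hβ : 0 < β)
    (h1 : β ∉ P.A1) (h2 : β ∉ P.A2) (h3 : β ∉ P.A3) :
    (P.ω1inv β).Nonempty ∧ (P.ω2inv β).Nonempty ∧ P.M β = P.zTilde β ∪ P.zBar β := by
  have key : (∃ y ∈ P.ω1inv β, P.g' y = c) ∧ ∃ w ∈ P.ω2inv β, P.g' w = c := by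
    obtain ⟨z, hz⟩ := P.M_nonempty hβ
    rcases H.mem_M_cases hc hβ hz with ⟨-, y, hy, e⟩ | ⟨-, hw, e, -⟩
    · refine ⟨⟨y, hy, e⟩, ?_⟩
      -- If no point of `ω2inv` has level `c`, all of them lie strictly higher (vacuously when there
      -- are none), which is membership in `A1`.
      by_contra! hne
      exact h1 ⟨hβ, y, hy, fun w hw =>
        e ▸ (H.le_g'_of_mem_ω2inv hc hβ hw).lt_of_ne (hne w hw).symm⟩
    · refine ⟨?_, ⟨_, hw, e⟩⟩
      by_contra! hne
      exact h2 ⟨hβ, _, hw, fun y hy =>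
        e ▸ (H.le_g'_of_mem_ω1inv hc hβ hy).lt_of_ne (hne y hy).symm⟩
  obtain ⟨⟨y, hy, ey⟩, w, hw, ew⟩ := key
  refine ⟨⟨y, hy⟩, ⟨w, hw⟩, Subset.antisymm (fun z hz => ?_)
    (union_subset (H.zTilde_subset_M hc hy ey) (H.zBar_subset_M hc hβ hw ew h3))⟩
  exact (H.mem_M_cases hc hβ hz).imp And.left And.left

theorem ωinv_union_nonempty (H : P.TwoValleys) (hβ : 0 < β) :
    (P.ω1inv β ∪ P.ω2inv β).Nonempty := by
  obtain ⟨c, hc⟩ := P.exists_isOptimalLevel hβ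
  obtain ⟨z, hz⟩ := P.M_nonempty hβ
  rcases H.mem_M_cases hc hβ hz with ⟨-, y, hy, -⟩ | ⟨-, hw, -⟩
  · exact ⟨y, Or.inl hy⟩
  · exact ⟨_, Or.inr hw⟩

end TwoValleys

end Model

/-! ### The four cases together -/

theorem mainTheorem3 (P : Model) (hμp : 0 < P.μp) (hμm : 0 < P.μm) (β : ℝ) (hβ : 0 < β) :
    (P.CaseI →
      Set.BijOn (P.φ P.a) (Set.Ici P.a) (Set.Ici 0) ∧
      P.M β = {(P.invL P.a (P.g' (P.φinv P.a β)), P.φinv P.a β)}) ∧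
    (P.CaseII →
      Set.BijOn (P.φ P.x0) (Set.Ici P.x0) (Set.Ici 0) ∧
      P.M β = {(P.invL P.x0 (P.g' (P.φinv P.x0 β)), P.φinv P.x0 β)}) ∧
    (P.CaseIII →
      Set.BijOn (P.φ P.a1) (Set.Ici P.a1) (Set.Ici 0) ∧
      P.M β = {(P.invL P.a1 (P.g' (P.φinv P.a1 β)), P.φinv P.a1 β)}) ∧
    (P.CaseIV →
      -- the inverse branches of `g'` are well defined
      (P.a < P.x0 ∧
        Set.BijOn P.g' (Set.Icc P.a1 P.a) (Set.Icc (P.g' P.a1) (P.g' P.a)) ∧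
        Set.BijOn P.g' (Set.Icc P.a P.x0) (Set.Icc (P.g' P.x0) (P.g' P.a)) ∧
        Set.BijOn P.g' (Set.Ici P.x0) (Set.Ici (P.g' P.x0))) ∧
      -- the inverses of `ω₁` and `ω₂` at `β`
      ((P.ω1inv β ∪ P.ω2inv β).Nonempty ∧
        (P.ω2inv β).Subsingleton ∧
        (β ≠ P.ω1 P.x2 → (P.ω1inv β).Subsingleton) ∧
        (β = P.ω1 P.x2 → P.a5 < P.x2 →
          P.ω1inv β = {P.inv2 (P.g' P.x2), P.x2}) ∧
        (β = P.ω1 P.x2 → P.x2 = P.a5 → P.ω1inv β = {P.x2})) ∧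
      -- the maximizers
      (β ∈ P.A1 ∪ P.A3 → (P.ω1inv β).Nonempty ∧ P.M β = P.zTilde β) ∧
      (β ∈ P.A2 ∩ (Set.Ioi 0 \ P.A3) → (P.ω2inv β).Nonempty ∧ P.M β = P.zBar β) ∧
      (β ∈ Set.Ioi 0 \ (P.A1 ∪ P.A2 ∪ P.A3) →
        (P.ω1inv β).Nonempty ∧ (P.ω2inv β).Nonempty ∧ P.M β = P.zTilde β ∪ P.zBar β) ∧
      P.A2 ∩ P.A3 = ∅) := by
  refine ⟨fun h => ?_, fun h => ?_, fun h => ?_, fun h => ?_⟩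
  · obtain ⟨h1, h2⟩ := h.shape hμp
    exact ⟨Model.bijOn_φ_of_valley h1 h2 P.a_pos.le, Model.M_eq_of_valley h1 h2 P.a_pos.le hβ⟩
  · obtain ⟨h0, h1, h2⟩ := h.shape hμp
    have hx0 := P.a_pos.le.trans h0
    exact ⟨Model.bijOn_φ_of_valley h1 h2 hx0, Model.M_eq_of_valley h1 h2 hx0 hβ⟩
  · obtain ⟨h1, h2⟩ := h.shape hμp
    have ha1 := (Model.a1_pos hμm).le
    exact ⟨Model.bijOn_φ_of_valley h1 h2 ha1, Model.M_eq_of_valley h1 h2 ha1 hβ⟩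
  · have H := h.twoValleys hμp hμm
    obtain ⟨c, hc⟩ := P.exists_isOptimalLevel hβ
    refine ⟨⟨H.a_lt_x0, H.bijOn₂, H.bijOn₃, H.bijOn₄⟩,
      ⟨H.ωinv_union_nonempty hβ, H.ω2inv_subsingleton β, H.ω1inv_subsingleton, H.ω1inv_eq_pair,
        H.ω1inv_eq_singleton hβ⟩, fun hA => ?_, fun hA => ?_, fun hA => ?_, H.A2_inter_A3⟩
    · obtain ⟨⟨y, hy, -⟩, hM⟩ := hA.elim (H.M_eq_zTilde_of_mem_A1 hc hβ)
        (H.M_eq_zTilde_of_mem_A3 hc hβ)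
      exact ⟨⟨y, hy⟩, hM⟩
    · obtain ⟨-, w, hw, -⟩ := id hA.1
      exact ⟨⟨w, hw⟩, H.M_eq_zBar_of_mem_A2 hc hβ hA.1⟩
    · have hA' := hA.2
      simp only [Set.mem_union, not_or] at hA'
      exact H.M_eq_union hc hβ hA'.1.1 hA'.1.2 hA'.2
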